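/- For a function $f:[0,1]\to(0,1)$, the generalized reinforced random walk $(X_n)_{n\ge 0}$ on $\mathbb{Z}$ associated to $f$, started at $0$ with all initial urns equal to $(\alpha_0,l_0)\in[0,1]\times(0,\infty)$, is defined as follows. $X_0=0$. Given $X_0,\dots,X_n$ with $X_n=x$, put $$\tilde\alpha_n^x=\frac{\alpha_0l_0+\#\{k<n: X_k=x,\ X_{k+1}=x+1\}}{l_0+\#\{k<n: X_k=x\}};$$ then $X_{n+1}=x+1$ with probability $f(\tilde\alpha_n^x)$ and $X_{n+1}=x-1$ with probability $1-f(\tilde\alpha_n^x)$. A path is recurrent if it visits every site of $\mathbb{Z}$ infinitely often, and transient if it converges to $+\infty$ or to $-\infty$. A point $p\in[0,1]$ is a stable fixed point of $f$ if $f(p)=p$ and $f'(p)\le 1$. **Theorem.** There exist a function $f:[0,1]\to(0,1)$ of class $C^3$, all of whose fixed points are isolated, with $f\ge 1/2$ on $[0,1]$ and with $1/2$ as its unique stable fixed point, and a real number $l_1>0$, such that for every real $l>0$ the walk associated to $f$, started at $0$ with all initial urns equal to $(1/2,l)$, is almost surely recurrent if $l\ge l_1$, and almost surely transient if $l<l_1$.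 -/

import Mathlib

open Set Filter Topology MeasureTheory ProbabilityTheory

/-- The standing assumptions on the urn function: `f : [0,1] → (0,1)` is of class `C³` and all
its fixed points are isolated. Only the values of `f` on `[0,1]` matter. -/
structure IsUrnFunction (f : ℝ → ℝ) : Prop where
  contDiffOn : ContDiffOn ℝ 3 f (Icc 0 1)
  mapsTo : MapsTo f (Icc 0 1) (Ioo 0 1)
  isolated : ∀ p ∈ Icc (0 : ℝ) 1, f p = p → ∀ᶠ x in 𝓝[≠] p, x ∈ Icc (0 : ℝ) 1 → f x ≠ x

/-- A fixed point `p ∈ [0,1]` of `f` is stable if `f' p ≤ 1` (the derivative is the one of `f` as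
a function on `[0,1]`). -/
def IsStableFixedPoint (f : ℝ → ℝ) (p : ℝ) : Prop :=
  p ∈ Icc (0 : ℝ) 1 ∧ f p = p ∧ derivWithin f (Icc 0 1) p ≤ 1

/-- An environment: the urn at the site `x` is `w x = (proportion of red balls, number of balls)`;
both are real. -/
abbrev UrnEnvironment : Type := ℤ → ℝ × ℝ

/-- The number of visits of the path `X` to the site `x` strictly before time `n`. -/
def visits (X : ℕ → ℤ) (n : ℕ) (x : ℤ) : ℕ :=
  ((Finset.range n).filter fun k => X k = x).card

/-- The number of jumps of the path `X` from `x` to `x + 1` up to time `n`. -/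
def rightJumps (X : ℕ → ℤ) (n : ℕ) (x : ℤ) : ℕ :=
  ((Finset.range n).filter fun k => X k = x ∧ X (k + 1) = x + 1).card

/-- The proportion of red balls at time `n` in the urn at `x`, when the initial environment is `w`,
and the walk has followed the path `X` up to time `n`. -/
noncomputable def redProportion (w : UrnEnvironment) (X : ℕ → ℤ) (n : ℕ) (x : ℤ) : ℝ :=
  ((w x).1 * (w x).2 + rightJumps X n x) / ((w x).2 + visits X n x)

/-- A finite path `X 0, …, X n`, extended by `0` to all times. -/
def extendPath {n : ℕ} (h : Finset.Iic n → ℤ) (k : ℕ) : ℤ :=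
  if hk : k ≤ n then h ⟨k, Finset.mem_Iic.2 hk⟩ else 0

/-- The law of the next position given the path `h` up to time `n`: from the current position `x`
the walk jumps to `x + 1` with probability `f a` and to `x - 1` with probability `1 - f a`, where
`a` is the current proportion of red balls in the urn at `x`. The projection `Set.projIcc` only
records that `f a` is a probability; it is the identity when `f` maps `[0,1]` to itself. -/
noncomputable def stepKernel (f : ℝ → ℝ) (w : UrnEnvironment) (n : ℕ) :
    Kernel (Finset.Iic n → ℤ) ℤ :=
  Kernel.ofFunOfCountable fun h =>
    bernoulliMeasure (extendPath h n + 1) (extendPath h n - 1)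
      (projIcc (0 : ℝ) 1 zero_le_one (f (redProportion w (extendPath h) n (extendPath h n))))

instance (f : ℝ → ℝ) (w : UrnEnvironment) (n : ℕ) : IsMarkovKernel (stepKernel f w n) :=
  ⟨fun _ => by unfold stepKernel Kernel.ofFunOfCountable; dsimp; infer_instance⟩

/-- The law, on the space of paths `ℕ → ℤ`, of the generalized reinforced random walk associated
to `f`, started at `x₀` with initial environment `w`. -/
noncomputable def reinforcedWalkLaw (f : ℝ → ℝ) (x₀ : ℤ) (w : UrnEnvironment) :
    Measure (ℕ → ℤ) :=
  Kernel.trajMeasure (X := fun _ => ℤ) (Measure.dirac x₀) (stepKernel f w)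

instance (f : ℝ → ℝ) (x₀ : ℤ) (w : UrnEnvironment) :
    IsProbabilityMeasure (reinforcedWalkLaw f x₀ w) := by
  unfold reinforcedWalkLaw; infer_instance

/-- The path visits every site infinitely often. -/
def IsRecurrentPath (X : ℕ → ℤ) : Prop :=
  ∀ x : ℤ, ∃ᶠ n in atTop, X n = x

/-- The path converges to `+∞` or to `-∞`. -/
def IsTransientPath (X : ℕ → ℤ) : Prop :=
  Tendsto X atTop atTop ∨ Tendsto X atTop atBot

/-!
Put on each site an independent stack of arrows, the successive draws of its urn; the walk is
then a deterministic function of the stacks. Let `Z n` be the number of jumps from `0` to `-1`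
before the first visit to `n`. It is nondecreasing in `n`; the walk is recurrent if `Z` and its
mirror image for the left side are unbounded, and transient if `Z` is bounded. Removing the stack
at `0` amounts to applying one step of a Markov kernel, and it does not affect whether `Z` is
bounded; hence on the event `A` that `Z` is bounded, as well as on its complement, the law of
`Z (n + 1)` is obtained from that of `Z n` by this kernel, which counts the left arrows of an urn
that precede its right arrow number `v`.

Suppose that the drift of the draws is nonnegative, and let `δ v` be its expected sum up to the
right arrow number `v`, with supremum `δ`. Optional stopping shows that the kernel has mean
`v + 1 - δ v`. If `δ > 1`, this becomes a negative drift when `Z` is unbounded, which is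
impossible for a nonnegative process; so `Z` is bounded. Exponential martingales give, on `A`,
`E [(1 - ε) ^ Z] ≤ E [(1 + ε) ^ (-Z - 1) + ε δ Z]` for the limit `Z`, and to first order in `ε`
this says `E [1 - δ Z] ≤ 0`; so `A` is null if `δ v < 1` for all `v`. This also applies on the
left, where the positive part of the drift vanishes. Thus the walk is transient if `δ > 1`, and
recurrent if `δ v < 1` for all `v`.

Take `f` equal to `1 / 2` on `[0, 19 / 20]` and larger beyond, without meeting the diagonal
again. With initial urns `(1 / 2, l)`, `δ` is nonincreasing in `l` by coupling and lower
semicontinuous; it exceeds `1` for small `l`, and it is below `1` for large `l` because reaching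
the proportion `19 / 20` becomes unlikely. Hence `δ ≤ 1` exactly from some threshold on, and
`δ ≤ 1` forces `δ v < 1`, since a long run of right arrows has positive drift.
-/

/-! ### Paths following stacks of arrows -/

/-- The number of `true`s among the first `n` entries of a sequence. -/
def heads (a : ℕ → Bool) (n : ℕ) : ℕ := Nat.count (fun i => a i = true) n

/-- The number of `false`s before the `(v + 1)`-th `true` of a sequence: if `a` is the stack of
arrows at a site (`true` pointing to the right), these are the jumps to the left made at the site
before its `(v + 1)`-th jump to the right. -/
noncomputable def backJumps (a : ℕ → Bool) (v : ℕ) : ℕ := Nat.nth (fun i => a i = true) v - v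

/-- The process of backward jumps `backJumps (ω 0) (backJumps (ω 1) (⋯ (backJumps (ω (n - 1)) 0)))`.
For stacks `ω` it counts the jumps from `0` to `-1` before the first visit to `n`. -/
noncomputable def backwardChain : (ℕ → ℕ → Bool) → ℕ → ℕ
  | _, 0 => 0
  | ω, n + 1 => backJumps (ω 0) (backwardChain (fun x => ω (x + 1)) n)

/-- Both values occur infinitely often in the sequence. -/
def IsMixed (a : ℕ → Bool) : Prop :=
  {i | a i = true}.Infinite ∧ {i | a i = false}.Infinite

/-- The path starts at `0` and uses the arrow `ω x i` at its `i`-th visit to `x`, counted from `0`;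
the value `true` stands for a jump to the right. -/
structure Follows (ω : ℤ → ℕ → Bool) (X : ℕ → ℤ) : Prop where
  zero : X 0 = 0
  succ : ∀ n, X (n + 1) = if ω (X n) (visits X n (X n)) then X n + 1 else X n - 1

/-- The stacks of arrows followed by the mirror image of a path. -/
def reflectStacks (ω : ℤ → ℕ → Bool) (x : ℤ) (i : ℕ) : Bool := !ω (-x) i

/-- The number of jumps of the path `X` from `x` to `x - 1` up to time `n`. -/
def leftJumps (X : ℕ → ℤ) (n : ℕ) (x : ℤ) : ℕ :=
  ((Finset.range n).filter fun k => X k = x ∧ X (k + 1) = x - 1).card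

lemma heads_zero (a : ℕ → Bool) : heads a 0 = 0 := by simp [heads]

lemma heads_succ (a : ℕ → Bool) (n : ℕ) :
    heads a (n + 1) = heads a n + if a n then 1 else 0 := by
  simp [heads, Nat.count_succ]

lemma heads_le (a : ℕ → Bool) (n : ℕ) : heads a n ≤ n := Nat.count_le _

lemma heads_congr {a b : ℕ → Bool} {n : ℕ} (h : ∀ i < n, a i = b i) : heads a n = heads b n := by
  induction n with
  | zero => simp only [heads_zero]
  | succ n ih =>
    rw [heads_succ, heads_succ, ih fun i hi => h i (hi.trans n.lt_succ_self), h n n.lt_succ_self]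

lemma heads_not (a : ℕ → Bool) (n : ℕ) : heads (fun i => !a i) n = n - heads a n := by
  induction n with
  | zero => simp [heads_zero]
  | succ n ih =>
    have hle := heads_le a n
    rw [heads_succ, heads_succ, ih]
    cases a n <;> simp
    omega

lemma IsMixed.not {a : ℕ → Bool} (h : IsMixed a) : IsMixed fun i => !a i := by
  simpa [IsMixed] using And.symm h

section Path

variable {ω : ℤ → ℕ → Bool} {X : ℕ → ℤ}

lemma visits_eq_count (X : ℕ → ℤ) (n : ℕ) (x : ℤ) :
    visits X n x = Nat.count (fun k => X k = x) n := by
  rw [visits, Nat.count_eq_card_filter_range]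

lemma visits_zero (X : ℕ → ℤ) (x : ℤ) : visits X 0 x = 0 := by simp [visits]

lemma visits_succ (X : ℕ → ℤ) (n : ℕ) (x : ℤ) :
    visits X (n + 1) x = visits X n x + if X n = x then 1 else 0 := by
  simp only [visits_eq_count, Nat.count_succ]

lemma visits_eq_zero {n : ℕ} {x : ℤ} (h : ∀ k < n, X k ≠ x) : visits X n x = 0 := by
  simpa [visits, Finset.filter_eq_empty_iff] using h

lemma visits_neg (X : ℕ → ℤ) (n : ℕ) (x : ℤ) : visits (fun k => -X k) n x = visits X n (-x) := by
  simp only [visits, neg_eq_iff_eq_neg]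

lemma rightJumps_succ (X : ℕ → ℤ) (n : ℕ) (x : ℤ) :
    rightJumps X (n + 1) x = rightJumps X n x + if X n = x ∧ X (n + 1) = x + 1 then 1 else 0 := by
  simp only [rightJumps, ← Nat.count_eq_card_filter_range, Nat.count_succ]

lemma leftJumps_succ (X : ℕ → ℤ) (n : ℕ) (x : ℤ) :
    leftJumps X (n + 1) x = leftJumps X n x + if X n = x ∧ X (n + 1) = x - 1 then 1 else 0 := by
  simp only [leftJumps, ← Nat.count_eq_card_filter_range, Nat.count_succ]

lemma exists_visit_eq {x : ℤ} (hx : ∃ᶠ n in atTop, X n = x) (i : ℕ) :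
    ∃ k ≥ i, X k = x ∧ visits X k x = i := by
  have hinf : {k | X k = x}.Infinite := Nat.frequently_atTop_iff_infinite.1 hx
  refine ⟨Nat.nth (fun k => X k = x) i, Nat.le_nth fun hf => absurd hf hinf,
    Nat.nth_mem_of_infinite hinf i, ?_⟩
  rw [visits_eq_count, Nat.count_nth_of_infinite hinf]

lemma isRecurrentPath_neg : IsRecurrentPath (fun n => -X n) ↔ IsRecurrentPath X := by
  simp only [IsRecurrentPath, neg_eq_iff_eq_neg]
  exact (Equiv.neg ℤ).forall_congr_left.trans (by simp)

namespace Follows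

lemma step (h : Follows ω X) (n : ℕ) : X (n + 1) = X n + 1 ∨ X (n + 1) = X n - 1 := by
  rw [h.succ n]; split_ifs <;> simp

lemma apply_le (h : Follows ω X) (n : ℕ) : X n ≤ n := by
  induction n with
  | zero => simp [h.zero]
  | succ n ih => rcases h.step n with hn | hn <;> push_cast <;> omega

lemma neg (h : Follows ω X) : Follows (reflectStacks ω) fun n => -X n where
  zero := by simp [h.zero]
  succ n := by
    rw [visits_neg, neg_neg, h.succ n, reflectStacks, neg_neg]
    cases ω (X n) (visits X n (X n)) <;> simp <;> ring

lemma rightJumps_eq_heads (h : Follows ω X) (n : ℕ) (x : ℤ) :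
    rightJumps X n x = heads (ω x) (visits X n x) := by
  induction n with
  | zero => simp [rightJumps, visits_zero, heads_zero]
  | succ n ih =>
    rw [rightJumps_succ, visits_succ, ih, h.succ n]
    by_cases hx : X n = x
    · subst hx
      rw [if_pos rfl, heads_succ]
      cases ω (X n) (visits X n (X n)) <;> simp
      omega
    · simp [hx]

lemma leftJumps_add_rightJumps (h : Follows ω X) (n : ℕ) (x : ℤ) :
    leftJumps X n x + rightJumps X n x = visits X n x := by
  induction n with
  | zero => simp [rightJumps, leftJumps, visits_zero]
  | succ n ih =>
    rw [rightJumps_succ, leftJumps_succ, visits_succ, ← ih]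
    rcases h.step n with hn | hn <;> rw [hn] <;> split_ifs <;> omega

/-- Up to time `n` the path crosses the edge from `x` to `x + 1` alternately in both directions. -/
lemma rightJumps_eq_leftJumps_add (h : Follows ω X) (n : ℕ) {x : ℤ} (hx : 0 ≤ x) :
    (rightJumps X n x : ℤ) = leftJumps X n (x + 1) + if x < X n then 1 else 0 := by
  induction n with
  | zero => simp [rightJumps, leftJumps, h.zero, not_lt.2 hx]
  | succ n ih =>
    rw [rightJumps_succ, leftJumps_succ]
    push_cast
    rw [ih]
    rcases h.step n with hn | hn <;> rw [hn] <;> split_ifs <;> omega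

lemma last_arrow_eq_true (h : Follows ω X) (n : ℕ) {x : ℤ} (hx : x < X n) {m : ℕ}
    (hm : visits X n x = m + 1) : ω x m = true := by
  induction n with
  | zero => simp [visits_zero] at hm
  | succ n ih =>
    rw [visits_succ] at hm
    by_cases hn : X n = x
    · have hstep := h.succ n
      rw [if_pos hn, Nat.add_right_cancel_iff] at hm
      rw [hn, hm] at hstep
      by_contra hleft
      rw [if_neg hleft] at hstep
      omega
    · rw [if_neg hn] at hm
      refine ih ?_ hm
      rcases h.step n with hstep | hstep <;> omega

lemma leftJumps_eq_backJumps (h : Follows ω X) (n : ℕ) {x : ℤ} (hx0 : 0 ≤ x)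
    (hx : x < X n) : leftJumps X n x = backJumps (ω x) (leftJumps X n (x + 1)) := by
  have hcross := h.rightJumps_eq_leftJumps_add n hx0
  rw [if_pos hx] at hcross
  have hvisits := h.leftJumps_add_rightJumps n x
  have hheads := h.rightJumps_eq_heads n x
  obtain ⟨m, hm⟩ : ∃ m, visits X n x = m + 1 := ⟨visits X n x - 1, by omega⟩
  have hlast := h.last_arrow_eq_true n hx hm
  rw [hm, heads_succ, if_pos hlast] at hheads
  have hprev : heads (ω x) m = leftJumps X n (x + 1) := by omega
  have hnth : Nat.nth (fun i => ω x i = true) (heads (ω x) m) = m := Nat.nth_count hlast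
  rw [backJumps, ← hprev, hnth]
  omega

lemma backwardChain_eq_leftJumps (h : Follows ω X) {T : ℕ} (m : ℕ) {x : ℤ} (hx : 0 ≤ x)
    (hT : X T = x + m) (hlt : ∀ k < T, X k < x + m) :
    backwardChain (fun y => ω (x + y)) m = leftJumps X T x := by
  induction m generalizing x with
  | zero =>
    have hvisits := h.leftJumps_add_rightJumps T x
    rw [visits_eq_zero fun k hk => by simpa using (hlt k hk).ne] at hvisits
    simp only [backwardChain]
    omega
  | succ m ih =>
    push_cast at hT hlt
    rw [h.leftJumps_eq_backJumps T hx (by omega), backwardChain,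
      ← ih (by omega) (by omega) fun k hk => by have := hlt k hk; omega]
    simp only [Nat.cast_zero, add_zero, Nat.cast_add, Nat.cast_one, add_assoc, add_comm (1 : ℤ)]

lemma exists_first_hit (h : Follows ω X) {K n : ℕ} (hn : (K : ℤ) ≤ X n) :
    ∃ T, X T = K ∧ ∀ k < T, X k < K := by
  classical
  have hex : ∃ n, (K : ℤ) ≤ X n := ⟨n, hn⟩
  refine ⟨Nat.find hex, ?_, fun k hk => not_le.1 (Nat.find_min hex hk)⟩
  have hspec := Nat.find_spec hex
  rcases hT : Nat.find hex with _ | T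
  · rw [hT, h.zero] at hspec
    rw [h.zero]; omega
  · have hmin := Nat.find_min hex (m := T) (by omega)
    rw [hT] at hspec
    rcases h.step T with hstep | hstep <;> omega

lemma exists_backwardChain_eq_leftJumps (h : Follows ω X) {K n : ℕ} (hn : (K : ℤ) ≤ X n) :
    ∃ T ≥ K, backwardChain (fun x => ω x) K = leftJumps X T 0 := by
  obtain ⟨T, hT, hlt⟩ := h.exists_first_hit hn
  refine ⟨T, by exact_mod_cast hT ▸ h.apply_le T, ?_⟩
  simpa using h.backwardChain_eq_leftJumps K le_rfl (by simpa using hT) (by simpa using hlt)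

lemma frequently_jump (h : Follows ω X) {x : ℤ} (hx : ∃ᶠ n in atTop, X n = x) {b : Bool}
    (hb : {i | ω x i = b}.Infinite) :
    ∃ᶠ n in atTop, X n = x ∧ X (n + 1) = if b then x + 1 else x - 1 := by
  rw [frequently_atTop]
  intro N
  obtain ⟨i, hi, hN⟩ := hb.exists_gt N
  obtain ⟨k, hk, hXk, hvisits⟩ := exists_visit_eq hx i
  refine ⟨k, by omega, hXk, ?_⟩
  have hstep := h.succ k
  rwa [hXk, hvisits, show ω x i = b from hi] at hstep

lemma frequently_succ_eq (h : Follows ω X) {x : ℤ} (hx : ∃ᶠ n in atTop, X n = x) {b : Bool}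
    (hb : {i | ω x i = b}.Infinite) : ∃ᶠ n in atTop, X n = if b then x + 1 else x - 1 :=
  (tendsto_add_atTop_nat 1).frequently ((h.frequently_jump hx hb).mono fun _ => And.right)

lemma isRecurrentPath (h : Follows ω X) (hω : ∀ x, IsMixed (ω x)) {x : ℤ}
    (hx : ∃ᶠ n in atTop, X n = x) : IsRecurrentPath X := by
  intro y
  induction y using Int.inductionOn' (b := x) with
  | zero => exact hx
  | succ k _ ih => exact h.frequently_succ_eq ih (hω k).1
  | pred k _ ih => simpa using h.frequently_succ_eq ih (hω k).2

lemma eventually_ne (h : Follows ω X) (hω : ∀ x, IsMixed (ω x)) (hr : ¬IsRecurrentPath X)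
    (x : ℤ) : ∀ᶠ n in atTop, X n ≠ x :=
  not_frequently.1 fun hx => hr (h.isRecurrentPath hω hx)

lemma pos_of_forall_ne_zero (h : Follows ω X) {N : ℕ} (hN : ∀ n ≥ N, X n ≠ 0) (hpos : 0 < X N) :
    ∀ n ≥ N, 0 < X n := by
  intro n hn
  induction n, hn using Nat.le_induction with
  | base => exact hpos
  | succ n hn ih =>
    have := hN (n + 1) (by omega)
    rcases h.step n with hstep | hstep <;> omega

lemma tendsto_atTop_of_pos (h : Follows ω X) (hω : ∀ x, IsMixed (ω x))
    (hr : ¬IsRecurrentPath X) {N : ℕ} (hN : ∀ n ≥ N, 0 < X n) : Tendsto X atTop atTop := by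
  have hgt : ∀ M : ℕ, ∀ᶠ n in atTop, (M : ℤ) < X n := by
    intro M
    induction M with
    | zero => exact eventually_atTop.2 ⟨N, by simpa using hN⟩
    | succ M ih =>
      filter_upwards [ih, h.eventually_ne hω hr (M + 1)] with n hlt hne
      push_cast
      omega
  refine tendsto_atTop.2 fun b => ?_
  filter_upwards [hgt b.toNat] with n hn
  omega

lemma isRecurrentPath_or_isTransientPath (h : Follows ω X) (hω : ∀ x, IsMixed (ω x)) :
    IsRecurrentPath X ∨ IsTransientPath X := by
  refine or_iff_not_imp_left.2 fun hr => ?_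
  obtain ⟨N, hN⟩ := eventually_atTop.1 (h.eventually_ne hω hr 0)
  rcases lt_or_gt_of_ne (hN N le_rfl) with hneg | hpos
  · refine Or.inr (tendsto_neg_atTop_iff.1 ?_)
    exact h.neg.tendsto_atTop_of_pos (fun x => (hω (-x)).not) (isRecurrentPath_neg.not.2 hr)
      (h.neg.pos_of_forall_ne_zero (fun n hn => neg_ne_zero.2 (hN n hn)) (neg_pos.2 hneg))
  · exact Or.inl (h.tendsto_atTop_of_pos hω hr (h.pos_of_forall_ne_zero hN hpos))

/-- If `X` tends to `+∞` then `0` is left only finitely often, which bounds the backward chain. -/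
lemma not_tendsto_atTop (h : Follows ω X)
    (hunb : ¬BddAbove (range (backwardChain fun x => ω x))) : ¬Tendsto X atTop atTop := by
  intro hlim
  obtain ⟨N, hN⟩ := eventually_atTop.1 (hlim.eventually_gt_atTop 0)
  refine hunb ⟨N, forall_mem_range.2 fun K => ?_⟩
  obtain ⟨n, hn⟩ := (hlim.eventually_ge_atTop (K : ℤ)).exists
  obtain ⟨T, -, hK⟩ := h.exists_backwardChain_eq_leftJumps hn
  rw [hK, ← Finset.card_range N]
  refine Finset.card_le_card fun k hk => ?_
  simp only [Finset.mem_filter, Finset.mem_range] at hk ⊢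
  exact not_le.1 fun hle => (hN k hle).ne' hk.2.1

lemma isRecurrentPath_of_not_bddAbove (h : Follows ω X) (hω : ∀ x, IsMixed (ω x))
    (hr : ¬BddAbove (range (backwardChain fun x => ω x)))
    (hl : ¬BddAbove (range (backwardChain fun x => reflectStacks ω x))) : IsRecurrentPath X := by
  rcases h.isRecurrentPath_or_isTransientPath hω with hrec | hright | hleft
  · exact hrec
  · exact absurd hright (h.not_tendsto_atTop hr)
  · exact absurd (tendsto_neg_atTop_iff.2 hleft) (h.neg.not_tendsto_atTop hl)

lemma not_isRecurrentPath (h : Follows ω X) (hω : IsMixed (ω 0))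
    (hbdd : BddAbove (range (backwardChain fun x => ω x))) : ¬IsRecurrentPath X := by
  intro hr
  obtain ⟨M, hM⟩ := hbdd
  have hinf : {k | X k = 0 ∧ X (k + 1) = 0 - 1}.Infinite := by
    simpa using Nat.frequently_atTop_iff_infinite.1 (h.frequently_jump (hr 0) hω.2)
  obtain ⟨s, hs, hcard⟩ := hinf.exists_subset_card_eq (M + 1)
  obtain ⟨K, hK⟩ := s.bddAbove
  obtain ⟨n, hn⟩ := (hr (K + 1 : ℕ)).exists
  obtain ⟨T, hT, hchain⟩ := h.exists_backwardChain_eq_leftJumps hn.ge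
  have hle : s.card ≤ leftJumps X T 0 := by
    refine Finset.card_le_card fun k hk => Finset.mem_filter.2 ⟨Finset.mem_range.2 ?_, hs hk⟩
    exact (Nat.lt_succ_of_le (hK hk)).trans_le hT
  have := hM (mem_range_self (K + 1))
  omega

lemma isTransientPath_of_bddAbove (h : Follows ω X) (hω : ∀ x, IsMixed (ω x))
    (hbdd : BddAbove (range (backwardChain fun x => ω x))) : IsTransientPath X :=
  (h.isRecurrentPath_or_isTransientPath hω).resolve_left (h.not_isRecurrentPath (hω 0) hbdd)

end Follows

end Path

/-! ### Urns -/

/-- The probability of the outcome `x` for the draw number `i` of an urn after `c` draws of `true`,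
when `p c i` is the probability of `true`. -/
noncomputable def drawProb (p : ℕ → ℕ → ℝ) (c i : ℕ) (x : Bool) : ENNReal :=
  ENNReal.ofReal (if x then p c i else 1 - p c i)

/-- `ν` is the law of the successive draws of an urn in which the draw number `i`, made after `c`
draws of `true`, is `true` with probability `p c i`. The condition only involves the probabilities
of finite sequences of draws. -/
def IsUrnLaw (p : ℕ → ℕ → ℝ) (ν : Measure (ℕ → Bool)) : Prop :=
  ∀ (b : ℕ → Bool) (j : ℕ), ν {a | ∀ i < j + 1, a i = b i} =
    drawProb p (heads b j) j (b j) * ν {a | ∀ i < j, a i = b i}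

/-- Extension of a finite sequence by `false`, used to name the finite sequences of draws. -/
def extendBool {m : ℕ} (b : Fin m → Bool) (i : ℕ) : Bool :=
  if h : i < m then b ⟨i, h⟩ else false

lemma extendBool_coe {m : ℕ} (b : Fin m → Bool) (i : Fin m) : extendBool b i = b i := by
  simp [extendBool]

lemma extendBool_snoc_self {m : ℕ} (b : Fin m → Bool) (x : Bool) :
    extendBool (Fin.snoc b x : Fin (m + 1) → Bool) m = x := by
  simp [extendBool, Fin.snoc]

lemma extendBool_snoc_of_lt {m : ℕ} (b : Fin m → Bool) (x : Bool) {i : ℕ} (hi : i < m) :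
    extendBool (Fin.snoc b x : Fin (m + 1) → Bool) i = extendBool b i := by
  simp [extendBool, Fin.snoc, hi, Nat.lt_succ_of_lt hi]

lemma measurableSet_apply_eq (i : ℕ) (x : Bool) : MeasurableSet {a : ℕ → Bool | a i = x} :=
  measurableSet_eq_fun (measurable_pi_apply i) measurable_const

lemma measurableSet_prefix (b : ℕ → Bool) (j : ℕ) :
    MeasurableSet {a : ℕ → Bool | ∀ i < j, a i = b i} := by
  simp only [ofPred_forall]
  exact .iInter fun i => .iInter fun _ => measurableSet_apply_eq i (b i)

lemma lintegral_eq_sum_prefix (ν : Measure (ℕ → Bool)) {m : ℕ} {Φ : (ℕ → Bool) → ENNReal}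
    (hΦ : ∀ a b : ℕ → Bool, (∀ i < m, a i = b i) → Φ a = Φ b) :
    ∫⁻ a, Φ a ∂ν =
      ∑ b : Fin m → Bool, Φ (extendBool b) * ν {a | ∀ i < m, a i = extendBool b i} := by
  have hrestrict : Measurable fun (a : ℕ → Bool) (i : Fin m) => a i := by fun_prop
  have hfactor : ∀ a, Φ a = Φ (extendBool fun i : Fin m => a i) := fun a =>
    hΦ _ _ fun i hi => (extendBool_coe (fun i : Fin m => a i) ⟨i, hi⟩).symm
  rw [lintegral_congr hfactor,
    ← lintegral_map (μ := ν) (f := fun b : Fin m → Bool => Φ (extendBool b))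
      (measurable_of_finite _) hrestrict, lintegral_fintype]
  refine Finset.sum_congr rfl fun b _ => ?_
  rw [Measure.map_apply hrestrict (measurableSet_singleton _)]
  congr 2
  ext a
  simp only [mem_preimage, mem_singleton_iff, mem_ofPred_eq, funext_iff, Fin.forall_iff]
  exact forall₂_congr fun i hi => by rw [← extendBool_coe b ⟨i, hi⟩]

namespace IsUrnLaw

variable {p : ℕ → ℕ → ℝ} {ν : Measure (ℕ → Bool)}

lemma measure_prefix_snoc (hν : IsUrnLaw p ν) {j : ℕ} (b : Fin j → Bool) (x : Bool) :
    ν {a | ∀ i < j + 1, a i = extendBool (Fin.snoc b x : Fin (j + 1) → Bool) i} =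
      drawProb p (heads (extendBool b) j) j x * ν {a | ∀ i < j, a i = extendBool b i} := by
  rw [hν, extendBool_snoc_self, heads_congr fun i hi => extendBool_snoc_of_lt b x hi]
  congr 2
  ext a
  exact forall₂_congr fun i hi => by rw [extendBool_snoc_of_lt b x hi]

lemma lintegral_heads_apply (hν : IsUrnLaw p ν) (j : ℕ) (G : ℕ → Bool → ENNReal) :
    ∫⁻ a, G (heads a j) (a j) ∂ν =
      ∫⁻ a, (ENNReal.ofReal (p (heads a j) j) * G (heads a j) true +
        ENNReal.ofReal (1 - p (heads a j) j) * G (heads a j) false) ∂ν := by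
  rw [lintegral_eq_sum_prefix ν (m := j + 1), lintegral_eq_sum_prefix ν (m := j)]
  · rw [← (Fin.snocEquiv fun _ => Bool).sum_comp, Fintype.sum_prod_type, Fintype.sum_bool,
      ← Finset.sum_add_distrib]
    refine Finset.sum_congr rfl fun b _ => ?_
    have hheads : ∀ x, heads (extendBool (Fin.snoc b x : Fin (j + 1) → Bool)) j =
        heads (extendBool b) j := fun x => heads_congr fun i hi => extendBool_snoc_of_lt b x hi
    simp only [Fin.snocEquiv, Equiv.coe_fn_mk, hν.measure_prefix_snoc, hheads,
      extendBool_snoc_self, drawProb, if_true, Bool.false_eq_true, if_false]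
    ring
  · intro a b hab
    rw [heads_congr hab]
  · intro a b hab
    rw [heads_congr fun i hi => hab i (hi.trans j.lt_succ_self), hab j j.lt_succ_self]

lemma map_not (hν : IsUrnLaw p ν) :
    IsUrnLaw (fun c i => 1 - p (i - c) i) (ν.map fun a i => !a i) := by
  have hmeas : Measurable fun (a : ℕ → Bool) (i : ℕ) => !a i := by fun_prop
  have hpreimage : ∀ (b : ℕ → Bool) (j : ℕ), (fun (a : ℕ → Bool) (i : ℕ) => !a i) ⁻¹'
      {a | ∀ i < j, a i = b i} = {a | ∀ i < j, a i = !b i} := by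
    intro b j
    ext a
    simp only [mem_preimage, mem_ofPred_eq, Bool.not_eq_eq_eq_not]
  intro b j
  rw [Measure.map_apply hmeas (measurableSet_prefix _ _),
    Measure.map_apply hmeas (measurableSet_prefix _ _), hpreimage, hpreimage, hν, heads_not]
  cases b j <;> simp [drawProb]

end IsUrnLaw

/-- The number of `true`s among the first draws of the urn driven by the uniform variables `u`. -/
noncomputable def urnHeads (p : ℕ → ℕ → ℝ) (u : ℕ → unitInterval) : ℕ → ℕ
  | 0 => 0
  | i + 1 => urnHeads p u i + if (u i : ℝ) ≤ p (urnHeads p u i) i then 1 else 0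

/-- The draws of the urn driven by the uniform variables `u`: the draw number `i` is `true` if and
only if `u i` is at most the probability of `true`. -/
noncomputable def urnDraws (p : ℕ → ℕ → ℝ) (u : ℕ → unitInterval) (i : ℕ) : Bool :=
  decide ((u i : ℝ) ≤ p (urnHeads p u i) i)

/-- The law of the draws of the urn with probabilities `p`, realized with independent uniform
variables so that urns with different `p` are coupled. -/
noncomputable def urnLaw (p : ℕ → ℕ → ℝ) : Measure (ℕ → Bool) :=
  (Measure.infinitePi fun _ : ℕ => (volume : Measure unitInterval)).map (urnDraws p)

lemma heads_urnDraws (p : ℕ → ℕ → ℝ) (u : ℕ → unitInterval) (i : ℕ) :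
    heads (urnDraws p u) i = urnHeads p u i := by
  induction i with
  | zero => simp [heads_zero, urnHeads]
  | succ i ih => simp [heads_succ, urnHeads, ih, urnDraws]

lemma measurable_urnHeads (p : ℕ → ℕ → ℝ) (i : ℕ) : Measurable fun u => urnHeads p u i := by
  induction i with
  | zero => exact measurable_const
  | succ i ih =>
    exact ih.add (.ite (measurableSet_le (by fun_prop)
      ((measurable_of_countable fun c => p c i).comp ih)) measurable_const measurable_const)

lemma measurable_urnDraws (p : ℕ → ℕ → ℝ) : Measurable (urnDraws p) := by
  refine measurable_pi_lambda _ fun i => measurable_to_bool ?_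
  have hpreimage : (fun u => urnDraws p u i) ⁻¹' {true} =
      {u | (u i : ℝ) ≤ p (urnHeads p u i) i} := by
    ext; simp [urnDraws]
  rw [hpreimage]
  exact measurableSet_le (by fun_prop)
    ((measurable_of_countable fun c => p c i).comp (measurable_urnHeads p i))

instance (p : ℕ → ℕ → ℝ) : IsProbabilityMeasure (urnLaw p) :=
  Measure.isProbabilityMeasure_map (measurable_urnDraws p).aemeasurable

lemma urnDraws_prefix_iff (p : ℕ → ℕ → ℝ) (u : ℕ → unitInterval) (b : ℕ → Bool) (j : ℕ) :
    (∀ i < j, urnDraws p u i = b i) ↔ ∀ i < j, decide ((u i : ℝ) ≤ p (heads b i) i) = b i := by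
  induction j with
  | zero => simp
  | succ j ih =>
    rw [Nat.forall_lt_succ_right, Nat.forall_lt_succ_right, ih]
    refine and_congr_right fun h => ?_
    rw [urnDraws, ← heads_urnDraws, heads_congr (ih.2 h)]

lemma urnLaw_prefix {p : ℕ → ℕ → ℝ} (hp : ∀ c i, p c i ∈ Icc (0 : ℝ) 1) (b : ℕ → Bool) (j : ℕ) :
    urnLaw p {a | ∀ i < j, a i = b i} = ∏ i ∈ Finset.range j, drawProb p (heads b i) i (b i) := by
  have hpreimage : urnDraws p ⁻¹' {a | ∀ i < j, a i = b i} =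
      Set.pi (Finset.range j : Finset ℕ) fun i =>
        if b i then Iic ⟨p (heads b i) i, hp _ _⟩ else Ioi ⟨p (heads b i) i, hp _ _⟩ := by
    ext u
    simp only [mem_preimage, mem_ofPred_eq, urnDraws_prefix_iff, Set.mem_pi, Finset.coe_range,
      mem_Iio]
    refine forall₂_congr fun i _ => ?_
    cases b i <;> simp [← Subtype.coe_le_coe, ← Subtype.coe_lt_coe]
  rw [urnLaw, Measure.map_apply (measurable_urnDraws p) (measurableSet_prefix b j), hpreimage,
    Measure.infinitePi_pi]
  · refine Finset.prod_congr rfl fun i _ => ?_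
    cases b i <;> simp [drawProb]
  · intro i _
    split_ifs
    exacts [measurableSet_Iic, measurableSet_Ioi]

lemma isUrnLaw_urnLaw {p : ℕ → ℕ → ℝ} (hp : ∀ c i, p c i ∈ Icc (0 : ℝ) 1) :
    IsUrnLaw p (urnLaw p) := by
  intro b j
  rw [urnLaw_prefix hp, urnLaw_prefix hp, Finset.prod_range_succ, mul_comm]

lemma ae_infinite_mem_infinitePi {α : Type*} [MeasurableSpace α] (μ : Measure α)
    [IsProbabilityMeasure μ] {s : Set α} (hs : MeasurableSet s) (h0 : μ s ≠ 0) :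
    ∀ᵐ u ∂(Measure.infinitePi fun _ : ℕ => μ), {i | u i ∈ s}.Infinite := by
  set P := Measure.infinitePi fun _ : ℕ => μ
  have hmeas : ∀ i : ℕ, MeasurableSet {u : ℕ → α | u i ∈ s} := fun i => measurable_pi_apply i hs
  have hind : iIndepSet (fun i : ℕ => {u : ℕ → α | u i ∈ s}) P := by
    have hcoord : iIndepFun (fun (i : ℕ) (u : ℕ → α) => u i) P :=
      iIndepFun_infinitePi (X := fun _ x => x) fun _ => measurable_id
    rw [iIndepSet_iff_meas_biInter hmeas]
    exact fun t => hcoord.measure_inter_preimage_eq_mul t (sets := fun _ => s) fun _ _ => hs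
  have hval : ∀ i : ℕ, P {u : ℕ → α | u i ∈ s} = μ s := fun i =>
    (measurePreserving_eval_infinitePi (fun _ : ℕ => μ) i).measure_preimage hs.nullMeasurableSet
  have hlimsup := measure_limsup_eq_one hmeas hind (by
    simp only [hval]
    exact ENNReal.tsum_const_eq_top_of_ne_zero h0)
  filter_upwards [(prob_compl_eq_zero_iff (.measurableSet_limsup hmeas)).2 hlimsup] with u hu
  rwa [mem_limsup_iff_frequently_mem, Nat.frequently_atTop_iff_infinite] at hu

lemma measurableSet_isMixed : MeasurableSet {a : ℕ → Bool | IsMixed a} := by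
  have hinf : ∀ x : Bool, MeasurableSet {a : ℕ → Bool | {i | a i = x}.Infinite} := by
    intro x
    have hlimsup : {a : ℕ → Bool | {i | a i = x}.Infinite} =
        limsup (fun i : ℕ => {a : ℕ → Bool | a i = x}) atTop := by
      ext a
      rw [mem_limsup_iff_frequently_mem, Nat.frequently_atTop_iff_infinite]
      rfl
    rw [hlimsup]
    exact .measurableSet_limsup fun i => measurableSet_apply_eq i x
  exact (hinf true).inter (hinf false)

lemma ae_isMixed_urnLaw {p : ℕ → ℕ → ℝ} {q : ℝ} (hq0 : 0 < q) (hq : ∀ c i, q ≤ p c i)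
    (hq' : ∀ c i, p c i ≤ 1 - q) : ∀ᵐ a ∂urnLaw p, IsMixed a := by
  rw [urnLaw, ae_map_iff (measurable_urnDraws p).aemeasurable measurableSet_isMixed]
  have hq_le : q ≤ 1 - q := (hq 0 0).trans (hq' 0 0)
  filter_upwards [ae_infinite_mem_infinitePi volume (s := Iic ⟨q, by constructor <;> linarith⟩)
      measurableSet_Iic (by simpa using hq0),
    ae_infinite_mem_infinitePi volume (s := Ioi ⟨1 - q, by constructor <;> linarith⟩)
      measurableSet_Ioi (by simpa using hq0)] with u hlow hhigh
  refine ⟨hlow.mono fun i hi => ?_, hhigh.mono fun i hi => ?_⟩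
  · have hi' : (u i : ℝ) ≤ q := hi
    simpa [urnDraws] using hi'.trans (hq _ _)
  · have hi' : 1 - q < (u i : ℝ) := hi
    simpa [urnDraws] using (hq' _ _).trans_lt hi'

lemma measurable_heads (n : ℕ) : Measurable fun a => heads a n := by
  induction n with
  | zero => simp [heads_zero]
  | succ n ih =>
    simp only [heads_succ]
    exact ih.add (.ite (measurableSet_apply_eq n true) measurable_const measurable_const)

/-! ### The reinforced walk follows independent stacks of urn draws -/

/-- The position and the numbers of past visits of the walk that follows the stacks `ω`. -/
def walkState (ω : ℤ → ℕ → Bool) : ℕ → ℤ × (ℤ → ℕ)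
  | 0 => (0, fun _ => 0)
  | n + 1 =>
    let s := walkState ω n
    (if ω s.1 (s.2 s.1) then s.1 + 1 else s.1 - 1, Function.update s.2 s.1 (s.2 s.1 + 1))

/-- The walk that follows the stacks `ω`. -/
def walk (ω : ℤ → ℕ → Bool) (n : ℕ) : ℤ := (walkState ω n).1

/-- Up to time `n`, the path starts at `0` and has steps `±1`. -/
def IsNearestNeighbor (X : ℕ → ℤ) (n : ℕ) : Prop :=
  X 0 = 0 ∧ ∀ k < n, X (k + 1) = X k + 1 ∨ X (k + 1) = X k - 1

/-- The stacks of arrows read off a path: the arrow `i` at `x` is the direction in which the path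
leaves `x` at its visit number `i`. It carries no information beyond the last visit to `x`. -/
noncomputable def pathArrows (X : ℕ → ℤ) (x : ℤ) (i : ℕ) : Bool :=
  decide (X (Nat.nth (fun k => X k = x) i + 1) = x + 1)

lemma walkState_snd (ω : ℤ → ℕ → Bool) (n : ℕ) (x : ℤ) :
    (walkState ω n).2 x = visits (walk ω) n x := by
  induction n generalizing x with
  | zero => simp [walkState, visits_zero]
  | succ n ih =>
    rw [visits_succ, ← ih, walkState]
    by_cases hx : walk ω n = x
    · subst hx
      simp [walk]
    · rw [if_neg hx, add_zero]
      exact Function.update_of_ne (Ne.symm hx) _ _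

lemma follows_walk (ω : ℤ → ℕ → Bool) : Follows ω (walk ω) where
  zero := rfl
  succ n := by rw [← walkState_snd]; rfl

lemma visits_congr {X Y : ℕ → ℤ} {n : ℕ} (h : ∀ k < n, X k = Y k) (x : ℤ) :
    visits X n x = visits Y n x :=
  congrArg _ (Finset.filter_congr fun k hk => by rw [h k (Finset.mem_range.1 hk)])

lemma rightJumps_congr {X Y : ℕ → ℤ} {n : ℕ} (h : ∀ k ≤ n, X k = Y k) (x : ℤ) :
    rightJumps X n x = rightJumps Y n x :=
  congrArg _ <| Finset.filter_congr fun k hk => by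
    rw [h k (Finset.mem_range.1 hk).le, h (k + 1) (Finset.mem_range.1 hk)]

lemma forall_lt_visits_succ_iff (X : ℕ → ℤ) (n : ℕ) (Q : ℤ → ℕ → Prop) :
    (∀ x, ∀ i < visits X (n + 1) x, Q x i) ↔
      (∀ x, ∀ i < visits X n x, Q x i) ∧ Q (X n) (visits X n (X n)) := by
  simp only [visits_succ]
  constructor
  · exact fun h => ⟨fun x i hi => h x i (by omega), h _ _ (by simp)⟩
  · rintro ⟨hold, hnew⟩ x i hi
    by_cases hx : X n = x
    · subst hx
      rw [if_pos rfl] at hi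
      rcases Nat.lt_succ_iff_lt_or_eq.1 hi with hi | rfl
      exacts [hold _ _ hi, hnew]
    · exact hold x i (by simpa [hx] using hi)

lemma pathArrows_visits (X : ℕ → ℤ) (n : ℕ) :
    pathArrows X (X n) (visits X n (X n)) = decide (X (n + 1) = X n + 1) := by
  rw [pathArrows, visits_eq_count, Nat.nth_count (p := fun k => X k = X n) rfl]

lemma heads_pathArrows (X : ℕ → ℤ) (n : ℕ) (x : ℤ) :
    heads (pathArrows X x) (visits X n x) = rightJumps X n x := by
  induction n with
  | zero => simp [rightJumps, visits_zero, heads_zero]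
  | succ n ih =>
    rw [rightJumps_succ, visits_succ, ← ih]
    by_cases hx : X n = x
    · subst hx
      rw [if_pos rfl, heads_succ, pathArrows_visits]
      simp
    · simp [hx]

lemma walk_prefix_succ_iff (ω : ℤ → ℕ → Bool) (n : ℕ) (h : ℕ → ℤ) :
    (∀ k ≤ n + 1, walk ω k = h k) ↔ (∀ k ≤ n, walk ω k = h k) ∧
      h (n + 1) = if ω (h n) (visits h n (h n)) then h n + 1 else h n - 1 := by
  have hsplit : (∀ k ≤ n + 1, walk ω k = h k) ↔
      (∀ k ≤ n, walk ω k = h k) ∧ walk ω (n + 1) = h (n + 1) := by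
    simp only [← Nat.lt_succ_iff, Nat.forall_lt_succ_right]
  rw [hsplit]
  refine and_congr_right fun hω => ?_
  rw [(follows_walk ω).succ, visits_congr fun k hk => hω k hk.le, hω n le_rfl, eq_comm]

lemma walk_prefix_iff (ω : ℤ → ℕ → Bool) (n : ℕ) (h : ℕ → ℤ) :
    (∀ k ≤ n, walk ω k = h k) ↔
      IsNearestNeighbor h n ∧ ∀ x, ∀ i < visits h n x, ω x i = pathArrows h x i := by
  induction n with
  | zero => simp [IsNearestNeighbor, visits_zero, (follows_walk ω).zero, eq_comm]
  | succ n ih =>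
    have hstep : (h (n + 1) = if ω (h n) (visits h n (h n)) then h n + 1 else h n - 1) ↔
        (h (n + 1) = h n + 1 ∨ h (n + 1) = h n - 1) ∧
          ω (h n) (visits h n (h n)) = decide (h (n + 1) = h n + 1) := by
      cases ω (h n) (visits h n (h n)) <;>
        simp only [Bool.false_eq_true, if_true, if_false, true_eq_decide_iff,
          false_eq_decide_iff] <;>
        omega
    rw [walk_prefix_succ_iff, ih, hstep, forall_lt_visits_succ_iff, pathArrows_visits]
    simp only [IsNearestNeighbor, Nat.forall_lt_succ_right]
    tauto

lemma measurableSet_stacks_prefix (v : ℤ → ℕ) (b : ℤ → ℕ → Bool) :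
    MeasurableSet {ω : ℤ → ℕ → Bool | ∀ x, ∀ i < v x, ω x i = b x i} := by
  rw [ofPred_forall]
  exact .iInter fun x => (measurableSet_prefix (b x) (v x)).preimage (measurable_pi_apply x)

lemma measurableSet_walk_prefix (n : ℕ) (h : ℕ → ℤ) :
    MeasurableSet {ω | ∀ k ≤ n, walk ω k = h k} := by
  simp only [walk_prefix_iff]
  exact (MeasurableSet.const _).inter (measurableSet_stacks_prefix _ _)

section Stacks

variable (ν : ℤ → Measure (ℕ → Bool)) [∀ x, IsProbabilityMeasure (ν x)]

lemma infinitePi_stacks_prefix (s : Finset ℤ) (v : ℤ → ℕ) (b : ℤ → ℕ → Bool)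
    (hs : ∀ x ∉ s, v x = 0) :
    Measure.infinitePi ν {ω | ∀ x, ∀ i < v x, ω x i = b x i} =
      ∏ x ∈ s, ν x {a | ∀ i < v x, a i = b x i} := by
  rw [← Measure.infinitePi_pi (μ := ν) fun x _ => measurableSet_prefix (b x) (v x)]
  congr 1
  ext ω
  simp only [mem_ofPred_eq, Set.mem_pi, Finset.mem_coe]
  refine ⟨fun h x _ => h x, fun h x => ?_⟩
  by_cases hx : x ∈ s
  · exact h x hx
  · simp [hs x hx]

variable {ν} {p : ℤ → ℕ → ℕ → ℝ}

lemma infinitePi_pathArrows_succ (hν : ∀ x, IsUrnLaw (p x) (ν x)) (n : ℕ) (h : ℕ → ℤ) :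
    Measure.infinitePi ν {ω | ∀ x, ∀ i < visits h (n + 1) x, ω x i = pathArrows h x i} =
      Measure.infinitePi ν {ω | ∀ x, ∀ i < visits h n x, ω x i = pathArrows h x i} *
        drawProb (p (h n)) (rightJumps h n (h n)) (visits h n (h n))
          (decide (h (n + 1) = h n + 1)) := by
  set s : Finset ℤ := (Finset.range (n + 1)).image h
  have hmem : h n ∈ s := Finset.mem_image_of_mem h (Finset.self_mem_range_succ n)
  have hzero : ∀ m ≤ n + 1, ∀ x ∉ s, visits h m x = 0 := fun m hm x hx =>
    visits_eq_zero fun k hk hkx => hx <| Finset.mem_image.2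
      ⟨k, Finset.mem_range.2 (hk.trans_le hm), hkx⟩
  have hothers : ∏ x ∈ s.erase (h n), ν x {a | ∀ i < visits h (n + 1) x, a i = pathArrows h x i} =
      ∏ x ∈ s.erase (h n), ν x {a | ∀ i < visits h n x, a i = pathArrows h x i} :=
    Finset.prod_congr rfl fun x hx => by
      rw [visits_succ, if_neg (Finset.ne_of_mem_erase hx).symm, add_zero]
  rw [infinitePi_stacks_prefix ν s _ _ (hzero _ le_rfl),
    infinitePi_stacks_prefix ν s _ _ (hzero _ n.le_succ), ← Finset.mul_prod_erase s _ hmem,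
    hothers, visits_succ, if_pos rfl, hν, heads_pathArrows, pathArrows_visits, mul_assoc, mul_comm,
    Finset.mul_prod_erase s (fun x => ν x {a | ∀ i < visits h n x, a i = pathArrows h x i}) hmem]

lemma infinitePi_walk_prefix_succ (hν : ∀ x, IsUrnLaw (p x) (ν x)) (n : ℕ) (h : ℕ → ℤ) :
    Measure.infinitePi ν {ω | ∀ k ≤ n + 1, walk ω k = h k} =
      Measure.infinitePi ν {ω | ∀ k ≤ n, walk ω k = h k} *
        if h (n + 1) = h n + 1 ∨ h (n + 1) = h n - 1 then
          drawProb (p (h n)) (rightJumps h n (h n)) (visits h n (h n))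
            (decide (h (n + 1) = h n + 1))
        else 0 := by
  have hsucc : IsNearestNeighbor h (n + 1) ↔
      IsNearestNeighbor h n ∧ (h (n + 1) = h n + 1 ∨ h (n + 1) = h n - 1) := by
    simp only [IsNearestNeighbor, Nat.forall_lt_succ_right, and_assoc]
  simp only [walk_prefix_iff, hsucc]
  by_cases hn : IsNearestNeighbor h n
  · split_ifs with hstep
    · simpa only [hn, hstep, true_and] using infinitePi_pathArrows_succ hν n h
    · simp [hstep]
  · simp [hn]

end Stacks

section PathSpace

variable {E : Type*}

lemma frestrictLe_preimage_singleton (n : ℕ) (h : ℕ → E) :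
    Preorder.frestrictLe (π := fun _ => E) n ⁻¹' {fun k : Finset.Iic n => h k} =
      {X | ∀ k ≤ n, X k = h k} := by
  ext X
  simp only [mem_preimage, mem_singleton_iff, funext_iff, Subtype.forall, Finset.mem_Iic,
    Preorder.frestrictLe_apply, mem_ofPred_eq]

lemma exists_eq_frestrictLe (n : ℕ) (q : Finset.Iic n → E) :
    ∃ h : ℕ → E, (fun k : Finset.Iic n => h k) = q :=
  ⟨Function.extend Subtype.val q fun _ => q ⟨n, Finset.mem_Iic.2 le_rfl⟩,
    funext fun k => Subtype.val_injective.extend_apply q _ k⟩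

variable [MeasurableSpace E]

lemma measurable_of_measurableSet_prefix [Countable E] {Ω : Type*} [MeasurableSpace Ω]
    {Y : Ω → ℕ → E}
    (hY : ∀ (n : ℕ) (h : ℕ → E), MeasurableSet {ω | ∀ k ≤ n, Y ω k = h k}) : Measurable Y := by
  refine measurable_pi_lambda _ fun n => ?_
  have hrestrict : Measurable fun ω (k : Finset.Iic n) => Y ω k := by
    refine measurable_to_countable' fun q => ?_
    obtain ⟨h, rfl⟩ := exists_eq_frestrictLe n q
    simpa [preimage, funext_iff] using hY n h
  exact (measurable_pi_apply (⟨n, Finset.mem_Iic.2 le_rfl⟩ : Finset.Iic n)).comp hrestrict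

variable [MeasurableSingletonClass E]

lemma measurableSet_path_prefix (n : ℕ) (h : ℕ → E) :
    MeasurableSet {X : ℕ → E | ∀ k ≤ n, X k = h k} := by
  rw [← frestrictLe_preimage_singleton]
  exact Preorder.measurable_frestrictLe n (measurableSet_singleton _)

section Traj

variable {μ₀ : Measure E} (κ : (n : ℕ) → Kernel (Finset.Iic n → E) E)
  [∀ n, IsMarkovKernel (κ n)]

lemma trajMeasure_prefix_zero (h : ℕ → E) :
    Kernel.trajMeasure (X := fun _ => E) μ₀ κ {X | ∀ k ≤ 0, X k = h k} = μ₀ {h 0} := by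
  have hmap : (Kernel.trajMeasure (X := fun _ => E) μ₀ κ).map (Preorder.frestrictLe 0) =
      μ₀.map (MeasurableEquiv.piUnique fun _ : Finset.Iic 0 => E).symm := by
    rw [Kernel.trajMeasure, Measure.map_comp _ _ (by fun_prop), Kernel.traj_map_frestrictLe,
      Kernel.partialTraj_self, Measure.id_comp]
  rw [← frestrictLe_preimage_singleton, ← Measure.map_apply (by fun_prop)
    (measurableSet_singleton _), hmap, Measure.map_apply (by fun_prop) (measurableSet_singleton _)]
  congr 1
  ext z
  rw [mem_preimage, mem_singleton_iff, mem_singleton_iff, MeasurableEquiv.symm_apply_eq]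
  rfl

lemma trajMeasure_prefix_succ [IsProbabilityMeasure μ₀] (n : ℕ) (h : ℕ → E) :
    Kernel.trajMeasure (X := fun _ => E) μ₀ κ {X | ∀ k ≤ n + 1, X k = h k} =
      Kernel.trajMeasure (X := fun _ => E) μ₀ κ {X | ∀ k ≤ n, X k = h k} *
        κ n (fun k => h k) {h (n + 1)} := by
  have hpreimage : (fun X : ℕ → E => (Preorder.frestrictLe (π := fun _ => E) n X, X (n + 1))) ⁻¹'
      ({fun k : Finset.Iic n => h k} ×ˢ {h (n + 1)}) = {X | ∀ k ≤ n + 1, X k = h k} := by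
    rw [mk_preimage_prod, frestrictLe_preimage_singleton]
    ext X
    simp only [mem_inter_iff, mem_preimage, mem_singleton_iff, mem_ofPred_eq, ← Nat.lt_succ_iff,
      Nat.forall_lt_succ_right]
  have hjoint := congrArg (fun m => m ({fun k : Finset.Iic n => h k} ×ˢ {h (n + 1)}))
    (Kernel.map_frestrictLe_trajMeasure_compProd_eq_map_trajMeasure
      (X := fun _ => E) (κ := κ) (μ₀ := μ₀) (a := n))
  rw [Measure.compProd_apply_prod (measurableSet_singleton _) (measurableSet_singleton _),
    Measure.restrict_singleton, lintegral_smul_measure, lintegral_dirac,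
    Measure.map_apply (by fun_prop) (measurableSet_singleton _), Measure.map_apply (by fun_prop)
      ((measurableSet_singleton _).prod (measurableSet_singleton _)),
    frestrictLe_preimage_singleton, hpreimage, smul_eq_mul] at hjoint
  exact hjoint.symm

end Traj

lemma path_measure_ext [Countable E] {μ ν : Measure (ℕ → E)} [IsFiniteMeasure μ]
    (hprefix : ∀ (n : ℕ) (h : ℕ → E), μ {X | ∀ k ≤ n, X k = h k} = ν {X | ∀ k ≤ n, X k = h k}) :
    μ = ν := by
  have hmap : ∀ n : ℕ, μ.map (Preorder.frestrictLe (π := fun _ => E) n) =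
      ν.map (Preorder.frestrictLe (π := fun _ => E) n) := by
    refine fun n => Measure.ext_of_singleton fun q => ?_
    obtain ⟨h, rfl⟩ := exists_eq_frestrictLe n q
    rw [Measure.map_apply (by fun_prop) (measurableSet_singleton _),
      Measure.map_apply (by fun_prop) (measurableSet_singleton _),
      frestrictLe_preimage_singleton, hprefix]
  have hμ : IsProjectiveLimit μ fun I : Finset ℕ => μ.map I.restrict := fun _ => rfl
  have hν : IsProjectiveLimit ν fun I : Finset ℕ => μ.map I.restrict := by
    refine (isProjectiveLimit_nat_iff (fun I J hJI => ?_) ν).2 fun n => (hmap n).symm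
    rw [Measure.map_map (by fun_prop) (by fun_prop)]
    rfl
  exact hμ.unique hν

end PathSpace

lemma measurable_walk : Measurable walk :=
  measurable_of_measurableSet_prefix measurableSet_walk_prefix

/-- The probability of a right jump from a site with initial urn `u` (proportion of red balls,
number of balls) after `i` visits and `c` right jumps. -/
noncomputable def urnProb (f : ℝ → ℝ) (u : ℝ × ℝ) (c i : ℕ) : ℝ :=
  f ((u.1 * u.2 + c) / (u.2 + i))

lemma bernoulliMeasure_singleton_of_add_of_sub (x y : ℤ) (t : unitInterval) :
    bernoulliMeasure (x + 1) (x - 1) t {y} =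
      if y = x + 1 ∨ y = x - 1 then ENNReal.ofReal (if y = x + 1 then t else 1 - t) else 0 := by
  have hofReal : ∀ t : unitInterval,
      ((unitInterval.toNNReal t : NNReal) : ENNReal) = ENNReal.ofReal t :=
    fun t => (ENNReal.ofReal_eq_coe_nnreal t.2.1).symm
  have hne : x - 1 ≠ x + 1 := by omega
  rw [bernoulliMeasure_def, Measure.add_apply, Measure.smul_apply, Measure.smul_apply,
    Measure.dirac_apply' _ (measurableSet_singleton _),
    Measure.dirac_apply' _ (measurableSet_singleton _)]
  by_cases hright : y = x + 1
  · subst hright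
    simp [hne, ENNReal.smul_def, hofReal]
  · by_cases hleft : y = x - 1
    · subst hleft
      simp [hne, hne.symm, ENNReal.smul_def, hofReal]
    · simp [hright, hleft, Ne.symm hright, Ne.symm hleft]

lemma stepKernel_apply_singleton {f : ℝ → ℝ} (hf : ∀ x, f x ∈ Icc (0 : ℝ) 1) (w : UrnEnvironment)
    (n : ℕ) (h : ℕ → ℤ) :
    stepKernel f w n (fun k => h k) {h (n + 1)} =
      if h (n + 1) = h n + 1 ∨ h (n + 1) = h n - 1 then
        drawProb (urnProb f (w (h n))) (rightJumps h n (h n)) (visits h n (h n))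
          (decide (h (n + 1) = h n + 1))
      else 0 := by
  have hext : ∀ k ≤ n, extendPath (fun k : Finset.Iic n => h k) k = h k := fun k hk => by
    simp [extendPath, hk]
  change bernoulliMeasure (extendPath (fun k : Finset.Iic n => h k) n + 1)
    (extendPath (fun k : Finset.Iic n => h k) n - 1) _ _ = _
  rw [hext n le_rfl, redProportion, rightJumps_congr hext,
    visits_congr fun k hk => hext k hk.le, bernoulliMeasure_singleton_of_add_of_sub,
    projIcc_of_mem zero_le_one (hf _)]
  simp only [drawProb, urnProb, decide_eq_true_eq]

lemma map_walk_infinitePi_urnLaw {f : ℝ → ℝ} (hf : ∀ x, f x ∈ Icc (0 : ℝ) 1)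
    (w : UrnEnvironment) :
    (Measure.infinitePi fun x => urnLaw (urnProb f (w x))).map walk = reinforcedWalkLaw f 0 w := by
  have : IsProbabilityMeasure
      ((Measure.infinitePi fun x => urnLaw (urnProb f (w x))).map walk) :=
    Measure.isProbabilityMeasure_map measurable_walk.aemeasurable
  refine path_measure_ext fun n h => ?_
  rw [Measure.map_apply measurable_walk (measurableSet_path_prefix n h),
    show walk ⁻¹' {X | ∀ k ≤ n, X k = h k} = {ω | ∀ k ≤ n, walk ω k = h k} from rfl]
  induction n with
  | zero =>
    rw [reinforcedWalkLaw, trajMeasure_prefix_zero, Measure.dirac_apply' _ (by simp)]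
    by_cases hzero : 0 = h 0 <;> simp [(follows_walk _).zero, hzero]
  | succ n ih =>
    rw [infinitePi_walk_prefix_succ (p := fun x => urnProb f (w x))
      (fun x => isUrnLaw_urnLaw fun _ _ => hf _), ih, reinforcedWalkLaw, trajMeasure_prefix_succ,
      stepKernel_apply_singleton hf]

/-! ### Backward jumps and drift -/

/-- The positive part of the drift of the draw number `i` made after `c` draws of `true`, counting
`true` as `1` and `false` as `-1`. -/
noncomputable def posDrift (p : ℕ → ℕ → ℝ) (c i : ℕ) : ENNReal := ENNReal.ofReal (2 * p c i - 1)

/-- The expected positive drift of the draws that are made up to the `(v + 1)`-th `true`. -/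
noncomputable def siteDrift (p : ℕ → ℕ → ℝ) (ν : Measure (ℕ → Bool)) (v : ℕ) : ENNReal :=
  ∑' j, ∫⁻ a, (if heads a j ≤ v then posDrift p (heads a j) j else 0) ∂ν

/-- The expected total positive drift of the draws of an urn. -/
noncomputable def totalDrift (p : ℕ → ℕ → ℝ) (ν : Measure (ℕ → Bool)) : ENNReal :=
  ∑' j, ∫⁻ a, posDrift p (heads a j) j ∂ν

lemma measurable_comp_heads {β : Type*} [MeasurableSpace β] (g : ℕ → β) (j : ℕ) :
    Measurable fun a => g (heads a j) :=
  (measurable_of_countable g).comp (measurable_heads j)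

lemma measurable_comp_heads_apply {β : Type*} [MeasurableSpace β] (g : ℕ → Bool → β) (j : ℕ) :
    Measurable fun a : ℕ → Bool => g (heads a j) (a j) :=
  (measurable_of_countable fun x : ℕ × Bool => g x.1 x.2).comp
    ((measurable_heads j).prodMk (measurable_pi_apply j))

lemma siteDrift_mono (p : ℕ → ℕ → ℝ) (ν : Measure (ℕ → Bool)) : Monotone (siteDrift p ν) := by
  refine fun v w hvw => ENNReal.tsum_le_tsum fun j => lintegral_mono fun a => ?_
  by_cases hv : heads a j ≤ v
  · simp only [if_pos hv, if_pos (hv.trans hvw), le_refl]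
  · simp only [if_neg hv, zero_le]

lemma exists_lt_siteDrift {p : ℕ → ℕ → ℝ} {ν : Measure (ℕ → Bool)} {c : ENNReal}
    (hc : c < totalDrift p ν) : ∃ v, c < siteDrift p ν v := by
  rw [totalDrift, ENNReal.tsum_eq_iSup_nat, lt_iSup_iff] at hc
  obtain ⟨m, hm⟩ := hc
  refine ⟨m, hm.trans_le ((Finset.sum_le_sum fun j hj => lintegral_mono fun a => ?_).trans
    (ENNReal.sum_le_tsum (Finset.range m)))⟩
  rw [if_pos ((heads_le a j).trans (Finset.mem_range.1 hj).le)]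

lemma siteDrift_add_le (p : ℕ → ℕ → ℝ) (ν : Measure (ℕ → Bool)) (v j : ℕ) :
    siteDrift p ν v + ∫⁻ a, (if v < heads a j then posDrift p (heads a j) j else 0) ∂ν ≤
      totalDrift p ν := by
  calc siteDrift p ν v + ∫⁻ a, (if v < heads a j then posDrift p (heads a j) j else 0) ∂ν
      ≤ siteDrift p ν v +
          ∑' i, ∫⁻ a, (if v < heads a i then posDrift p (heads a i) i else 0) ∂ν := by
        gcongr
        exact ENNReal.le_tsum (f := fun i =>
          ∫⁻ a, (if v < heads a i then posDrift p (heads a i) i else 0) ∂ν) j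
    _ = totalDrift p ν := by
        rw [siteDrift, totalDrift, ← ENNReal.tsum_add]
        refine tsum_congr fun i => ?_
        rw [← lintegral_add_left
          (measurable_comp_heads (fun c => if c ≤ v then posDrift p c i else 0) i)]
        refine lintegral_congr fun a => ?_
        rcases le_or_gt (heads a i) v with hv | hv
        · simp [hv, hv.not_gt]
        · simp [hv, hv.not_ge]

section StoppedSums

variable {a : ℕ → Bool}

lemma heads_nth_true_succ (ha : {i | a i = true}.Infinite) (v : ℕ) :
    heads a (Nat.nth (fun i => a i = true) v + 1) = v + 1 :=
  Nat.count_nth_succ_of_infinite ha v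

lemma tsum_ite_heads_le (ha : {i | a i = true}.Infinite) (v : ℕ) (g : ℕ → ENNReal) :
    ∑' j, (if heads a j ≤ v then g j else 0) =
      ∑ j ∈ Finset.range (Nat.nth (fun i => a i = true) v + 1), g j := by
  have hiff : ∀ j, heads a j ≤ v ↔ j ∈ Finset.range (Nat.nth (fun i => a i = true) v + 1) :=
    fun j => (Nat.count_le_iff_le_nth ha).trans (by simp)
  rw [tsum_eq_sum fun j hj => if_neg (mt (hiff j).1 hj)]
  exact Finset.sum_congr rfl fun j hj => if_pos ((hiff j).2 hj)

lemma sum_ite_eq_heads (a : ℕ → Bool) (n : ℕ) :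
    ∑ j ∈ Finset.range n, (if a j = true then 1 else 0 : ENNReal) = heads a n := by
  rw [Finset.sum_boole, heads, Nat.count_eq_card_filter_range]

lemma tsum_true_of_heads_le (ha : {i | a i = true}.Infinite) (v : ℕ) :
    ∑' j, (if heads a j ≤ v then (if a j = true then 1 else 0) else 0 : ENNReal) = v + 1 := by
  rw [tsum_ite_heads_le ha, sum_ite_eq_heads, heads_nth_true_succ ha, Nat.cast_succ]

lemma tsum_false_of_heads_le (ha : {i | a i = true}.Infinite) (v : ℕ) :
    ∑' j, (if heads a j ≤ v then (if a j = true then 0 else 1) else 0 : ENNReal) =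
      backJumps a v := by
  have hnot : ∀ j, (if a j = true then 0 else 1 : ENNReal) = if (!a j) = true then 1 else 0 :=
    fun j => by cases a j <;> rfl
  simp only [hnot]
  rw [tsum_ite_heads_le ha, sum_ite_eq_heads, heads_not, heads_nth_true_succ ha,
    Nat.add_sub_add_right, backJumps]

lemma tsum_true_of_heads_eq (ha : {i | a i = true}.Infinite) (v : ℕ)
    (g : ℕ → ENNReal) :
    ∑' j, (if heads a j = v ∧ a j = true then g j else 0) =
      g (Nat.nth (fun i => a i = true) v) := by
  rw [tsum_eq_single (Nat.nth (fun i => a i = true) v)]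
  · exact if_pos ⟨Nat.count_nth_of_infinite ha v, Nat.nth_mem_of_infinite ha v⟩
  · refine fun j hj => if_neg fun hjv => hj ?_
    rw [← hjv.1]
    exact (Nat.nth_count hjv.2).symm

end StoppedSums

/-- Wald's identity for the draws up to the `(v + 1)`-th `true`. -/
lemma lintegral_backJumps_add_siteDrift {p : ℕ → ℕ → ℝ} {ν : Measure (ℕ → Bool)}
    [IsProbabilityMeasure ν] (hν : IsUrnLaw p ν) (hinf : ∀ᵐ a ∂ν, {i | a i = true}.Infinite)
    (hp : ∀ c i, p c i ∈ Icc (1 / 2 : ℝ) 1) (v : ℕ) :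
    ∫⁻ a, (backJumps a v : ENNReal) ∂ν + siteDrift p ν v = v + 1 := by
  have hfalse : ∫⁻ a, (backJumps a v : ENNReal) ∂ν =
      ∑' j, ∫⁻ a, (if heads a j ≤ v then ENNReal.ofReal (1 - p (heads a j) j) else 0) ∂ν := by
    rw [lintegral_congr_ae (hinf.mono fun a ha => (tsum_false_of_heads_le ha v).symm),
      lintegral_tsum fun j => (measurable_comp_heads_apply
        (fun c x => if c ≤ v then (if x = true then 0 else 1 : ENNReal) else 0) j).aemeasurable]
    refine tsum_congr fun j => ?_
    rw [hν.lintegral_heads_apply j fun c x => if c ≤ v then (if x = true then 0 else 1) else 0]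
    refine lintegral_congr fun a => ?_
    split_ifs <;> simp_all
  have htrue : ((v : ENNReal) + 1) =
      ∑' j, ∫⁻ a, (if heads a j ≤ v then ENNReal.ofReal (p (heads a j) j) else 0) ∂ν := by
    have hconst : ((v : ENNReal) + 1) = ∫⁻ _, ((v : ENNReal) + 1) ∂ν := by simp
    rw [hconst, lintegral_congr_ae (hinf.mono fun a ha => (tsum_true_of_heads_le ha v).symm),
      lintegral_tsum fun j => (measurable_comp_heads_apply
        (fun c x => if c ≤ v then (if x = true then 1 else 0 : ENNReal) else 0) j).aemeasurable]
    refine tsum_congr fun j => ?_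
    rw [hν.lintegral_heads_apply j fun c x => if c ≤ v then (if x = true then 1 else 0) else 0]
    refine lintegral_congr fun a => ?_
    split_ifs <;> simp_all
  rw [hfalse, htrue, siteDrift, ← ENNReal.tsum_add]
  refine tsum_congr fun j => ?_
  rw [← lintegral_add_left (measurable_comp_heads
    (fun c => if c ≤ v then ENNReal.ofReal (1 - p c j) else 0) j)]
  refine lintegral_congr fun a => ?_
  split_ifs
  · obtain ⟨hhalf, hone⟩ := hp (heads a j) j
    rw [posDrift, ← ENNReal.ofReal_add (by linarith) (by linarith)]
    congr 1
    ring
  · rw [add_zero]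

/-- The multiplicative potential of `i` draws among which `c` are `true`. It is a martingale for
fair draws. -/
noncomputable def potential (ε : ℝ) (c i : ℕ) : ℝ := (1 + ε) ^ c * (1 - ε) ^ (i - c)

lemma potential_nonneg {ε : ℝ} (hε : ε ∈ Icc (0 : ℝ) 1) (c i : ℕ) : 0 ≤ potential ε c i :=
  mul_nonneg (pow_nonneg (by linarith [hε.1]) _) (pow_nonneg (by linarith [hε.2]) _)

lemma potential_le {ε : ℝ} (hε : ε ∈ Icc (0 : ℝ) 1) {c v : ℕ} (hc : c ≤ v) (i : ℕ) :
    potential ε c i ≤ (1 + ε) ^ v :=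
  calc (1 + ε) ^ c * (1 - ε) ^ (i - c) ≤ (1 + ε) ^ c * 1 := by
        have hpos : 0 ≤ 1 + ε := by linarith [hε.1]
        gcongr
        exact pow_le_one₀ (by linarith [hε.2]) (by linarith [hε.1])
    _ ≤ (1 + ε) ^ v := by
        rw [mul_one]
        exact pow_le_pow_right₀ (by linarith [hε.1]) hc

lemma potential_mean_le {ε : ℝ} (hε : ε ∈ Icc (0 : ℝ) 1) {q : ℝ} (hq : q ∈ Icc (0 : ℝ) 1)
    {c i v : ℕ} (hci : c ≤ i) (hcv : c ≤ v) :
    ENNReal.ofReal q * ENNReal.ofReal (potential ε (c + 1) (i + 1)) +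
        ENNReal.ofReal (1 - q) * ENNReal.ofReal (potential ε c (i + 1)) ≤
      ENNReal.ofReal (potential ε c i) +
        ENNReal.ofReal (ε * (1 + ε) ^ v) * ENNReal.ofReal (2 * q - 1) := by
  have hq1 : 0 ≤ 1 - q := by linarith [hq.2]
  have htrue : potential ε (c + 1) (i + 1) = potential ε c i * (1 + ε) := by
    rw [potential, potential, Nat.add_sub_add_right]
    ring
  have hfalse : potential ε c (i + 1) = potential ε c i * (1 - ε) := by
    rw [potential, potential, Nat.sub_add_comm hci]
    ring
  calc _ = ENNReal.ofReal (potential ε c i + ε * potential ε c i * (2 * q - 1)) := by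
        rw [← ENNReal.ofReal_mul hq.1, ← ENNReal.ofReal_mul hq1, ← ENNReal.ofReal_add
          (mul_nonneg hq.1 (potential_nonneg hε _ _)) (mul_nonneg hq1 (potential_nonneg hε _ _)),
          htrue, hfalse]
        congr 1
        ring
    _ ≤ ENNReal.ofReal (potential ε c i) +
          ENNReal.ofReal (ε * potential ε c i) * ENNReal.ofReal (2 * q - 1) := by
        rw [← ENNReal.ofReal_mul (mul_nonneg hε.1 (potential_nonneg hε _ _))]
        exact ENNReal.ofReal_add_le
    _ ≤ _ := by
        gcongr
        · exact hε.1
        · exact potential_le hε hcv i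

section ExitTime

variable {p : ℕ → ℕ → ℝ} {ν : Measure (ℕ → Bool)} {ε : ℝ}

lemma lintegral_potential_succ_add_exit_le (hν : IsUrnLaw p ν)
    (hp : ∀ c i, p c i ∈ Icc (0 : ℝ) 1) (hε : ε ∈ Icc (0 : ℝ) 1) (v j : ℕ) :
    ∫⁻ a, (if heads a (j + 1) ≤ v then
          ENNReal.ofReal (potential ε (heads a (j + 1)) (j + 1)) else 0) ∂ν +
        ∫⁻ a, (if heads a j = v ∧ a j = true then
          ENNReal.ofReal (potential ε (v + 1) (j + 1)) else 0) ∂ν ≤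
      ∫⁻ a, (if heads a j ≤ v then ENNReal.ofReal (potential ε (heads a j) j) else 0) ∂ν +
        ENNReal.ofReal (ε * (1 + ε) ^ v) *
          ∫⁻ a, (if heads a j ≤ v then posDrift p (heads a j) j else 0) ∂ν := by
  rw [← lintegral_add_left (measurable_comp_heads
      (fun c => if c ≤ v then ENNReal.ofReal (potential ε c (j + 1)) else 0) (j + 1)),
    ← lintegral_const_mul _ (measurable_comp_heads
      (fun c => if c ≤ v then posDrift p c j else 0) j),
    ← lintegral_add_left (measurable_comp_heads
      (fun c => if c ≤ v then ENNReal.ofReal (potential ε c j) else 0) j)]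
  let next (c : ℕ) (x : Bool) : ENNReal :=
    if c ≤ v then ENNReal.ofReal (potential ε (c + if x then 1 else 0) (j + 1)) else 0
  calc _ = ∫⁻ a, next (heads a j) (a j) ∂ν := by
        refine lintegral_congr fun a => ?_
        rw [heads_succ]
        cases a j
        · simp [next]
        · rcases lt_trichotomy (heads a j) v with hlt | rfl | hgt
          · simp [next, hlt.le, hlt.ne, Nat.succ_le_of_lt hlt]
          · simp [next]
          · simp [next, hgt.not_ge, hgt.ne', (hgt.trans (Nat.lt_succ_self _)).not_ge]
    _ ≤ _ := by
        rw [hν.lintegral_heads_apply]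
        refine lintegral_mono fun a => ?_
        by_cases hv : heads a j ≤ v
        · simpa [next, hv, posDrift] using potential_mean_le hε (hp _ _) (heads_le a j) hv
        · simp [next, hv]

lemma sum_exit_le [IsProbabilityMeasure ν] (hν : IsUrnLaw p ν)
    (hp : ∀ c i, p c i ∈ Icc (0 : ℝ) 1) (hε : ε ∈ Icc (0 : ℝ) 1) (v m : ℕ) :
    ∑ j ∈ Finset.range m, ∫⁻ a, (if heads a j = v ∧ a j = true then
        ENNReal.ofReal (potential ε (v + 1) (j + 1)) else 0) ∂ν +
      ∫⁻ a, (if heads a m ≤ v then ENNReal.ofReal (potential ε (heads a m) m) else 0) ∂ν ≤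
    1 + ENNReal.ofReal (ε * (1 + ε) ^ v) * ∑ j ∈ Finset.range m,
      ∫⁻ a, (if heads a j ≤ v then posDrift p (heads a j) j else 0) ∂ν := by
  induction m with
  | zero => simp [potential, heads_zero]
  | succ m ih =>
    rw [Finset.sum_range_succ, Finset.sum_range_succ, mul_add, ← add_assoc, add_assoc,
      add_comm (∫⁻ a, _ ∂ν) (∫⁻ a, _ ∂ν)]
    refine (add_le_add_right (lintegral_potential_succ_add_exit_le hν hp hε v m) _).trans ?_
    rw [← add_assoc]
    gcongr

lemma lintegral_pow_backJumps_le [IsProbabilityMeasure ν] (hν : IsUrnLaw p ν)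
    (hp : ∀ c i, p c i ∈ Icc (0 : ℝ) 1) (hε : ε ∈ Icc (0 : ℝ) 1) (v : ℕ)
    (hinf : ∀ᵐ a ∂ν, {i | a i = true}.Infinite) :
    ∫⁻ a, ENNReal.ofReal ((1 - ε) ^ backJumps a v) ∂ν ≤
      ENNReal.ofReal ((1 + ε) ^ (v + 1))⁻¹ + ENNReal.ofReal ε * siteDrift p ν v := by
  have hexit : ∑' j, ∫⁻ a, (if heads a j = v ∧ a j = true then
        ENNReal.ofReal (potential ε (v + 1) (j + 1)) else 0) ∂ν =
      ENNReal.ofReal ((1 + ε) ^ (v + 1)) * ∫⁻ a, ENNReal.ofReal ((1 - ε) ^ backJumps a v) ∂ν := by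
    rw [← lintegral_tsum fun j => (measurable_comp_heads_apply (fun c x => if c = v ∧ x = true then
      ENNReal.ofReal (potential ε (v + 1) (j + 1)) else 0) j).aemeasurable,
      ← lintegral_const_mul' _ _ ENNReal.ofReal_ne_top]
    refine lintegral_congr_ae (hinf.mono fun a ha => ?_)
    beta_reduce
    rw [tsum_true_of_heads_eq ha v fun j => ENNReal.ofReal (potential ε (v + 1) (j + 1)),
      potential, Nat.add_sub_add_right, ENNReal.ofReal_mul (pow_nonneg (by linarith [hε.1]) _),
      backJumps]
  have htotal : ENNReal.ofReal ((1 + ε) ^ (v + 1)) *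
      ∫⁻ a, ENNReal.ofReal ((1 - ε) ^ backJumps a v) ∂ν ≤
        1 + ENNReal.ofReal (ε * (1 + ε) ^ v) * siteDrift p ν v := by
    rw [← hexit, ENNReal.tsum_eq_iSup_nat]
    refine iSup_le fun m => (le_self_add.trans (sum_exit_le hν hp hε v m)).trans ?_
    gcongr
    exact ENNReal.sum_le_tsum _
  have hpos : 0 < 1 + ε := by linarith [hε.1]
  rw [← ENNReal.mul_le_mul_iff_right (ENNReal.ofReal_pos.2 (pow_pos hpos (v + 1))).ne'
    ENNReal.ofReal_ne_top, mul_add, ← ENNReal.ofReal_mul (by positivity),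
    mul_inv_cancel₀ (by positivity), ENNReal.ofReal_one, ← mul_assoc,
    ← ENNReal.ofReal_mul (by positivity)]
  refine htotal.trans ?_
  gcongr 1 + ENNReal.ofReal ?_ * _
  rw [mul_comm]
  gcongr
  · exact hε.1
  · linarith [hε.1]
  · exact v.le_succ

end ExitTime

/-! ### The process of backward jumps along independent stacks -/

lemma indepFun_head_tail {α : Type*} [MeasurableSpace α] (ν : Measure α) [IsProbabilityMeasure ν] :
    IndepFun (fun ω : ℕ → α => ω 0) (fun ω x => ω (x + 1)) (Measure.infinitePi fun _ : ℕ => ν) := by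
  have hcoord : iIndepFun (fun (x : ℕ) (ω : ℕ → α) => ω x) (Measure.infinitePi fun _ : ℕ => ν) :=
    iIndepFun_infinitePi (X := fun _ => id) fun _ => measurable_id
  refine IndepFun.indepFun_process (by fun_prop) (by fun_prop) fun I => ?_
  have hdisj : Disjoint ({0} : Finset ℕ) (I.map (addRightEmbedding 1)) := by simp
  have hhead : Measurable fun u : ({0} : Finset ℕ) → α => u ⟨0, Finset.mem_singleton_self 0⟩ :=
    measurable_pi_apply _
  have htail : Measurable fun (u : I.map (addRightEmbedding 1) → α) (x : I) =>
      u ⟨x + 1, Finset.mem_map_of_mem _ x.2⟩ :=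
    measurable_pi_lambda _ fun _ => measurable_pi_apply _
  exact (hcoord.indepFun_finset _ _ hdisj (by fun_prop)).comp hhead htail

lemma lintegral_head_tail {α : Type*} [MeasurableSpace α] (ν : Measure α)
    [IsProbabilityMeasure ν] {g : α → (ℕ → α) → ENNReal} (hg : Measurable (Function.uncurry g)) :
    ∫⁻ ω, g (ω 0) (fun x => ω (x + 1)) ∂(Measure.infinitePi fun _ : ℕ => ν) =
      ∫⁻ ω, ∫⁻ a, g a ω ∂ν ∂(Measure.infinitePi fun _ : ℕ => ν) := by
  have hlaw : (Measure.infinitePi fun _ : ℕ => ν).map (fun ω => (ω 0, fun x => ω (x + 1))) =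
      ν.prod (Measure.infinitePi fun _ : ℕ => ν) := by
    rw [(indepFun_head_tail ν).map_prod_eq_prod_map_map (measurable_pi_apply 0).aemeasurable
        (measurable_pi_lambda _ fun x => measurable_pi_apply (x + 1)).aemeasurable,
      Measure.infinitePi_map_eval,
      Measure.map_infinitePi_infinitePi_of_inj (add_left_injective 1)]
  calc ∫⁻ ω, g (ω 0) (fun x => ω (x + 1)) ∂(Measure.infinitePi fun _ : ℕ => ν)
    _ = ∫⁻ z, Function.uncurry g z ∂(ν.prod (Measure.infinitePi fun _ : ℕ => ν)) := by
      rw [← hlaw, lintegral_map hg (by fun_prop)]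
      rfl
    _ = _ := lintegral_prod_symm' _ hg

lemma nth_true_eq_iff (a : ℕ → Bool) (v m : ℕ) :
    Nat.nth (fun i => a i = true) v = m ↔
      (a m = true ∧ heads a m = v) ∨ (m = 0 ∧ ∀ k, ¬(a k = true ∧ heads a k = v)) := by
  by_cases hex : ∃ k, a k = true ∧ heads a k = v
  · obtain ⟨k, hk, rfl⟩ := hex
    rw [heads, Nat.nth_count hk]
    constructor
    · rintro rfl
      exact .inl ⟨hk, rfl⟩
    · rintro (⟨hm, heq⟩ | ⟨_, hnone⟩)
      · exact (Nat.count_injective hm hk heq).symm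
      · exact absurd ⟨hk, rfl⟩ (hnone k)
  · have hzero : Nat.nth (fun i => a i = true) v = 0 := by
      by_contra hne
      exact hex ⟨_, Nat.nth_mem_of_ne_zero hne,
        Nat.count_nth fun hf => Nat.lt_card_toFinset_of_nth_ne_zero hne hf⟩
    rw [hzero, or_iff_right fun hm => hex ⟨m, hm⟩, and_iff_left (not_exists.1 hex), eq_comm]

lemma measurable_backJumps (v : ℕ) : Measurable fun a => backJumps a v := by
  have hnext : ∀ k, MeasurableSet {a : ℕ → Bool | a k = true ∧ heads a k = v} := fun k =>
    (measurableSet_apply_eq k true).inter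
      (measurableSet_eq_fun (measurable_heads k) measurable_const)
  have hnone : MeasurableSet {a : ℕ → Bool | ∀ k, ¬(a k = true ∧ heads a k = v)} := by
    rw [ofPred_forall]
    exact .iInter fun k => (hnext k).compl
  have hnth : Measurable fun a : ℕ → Bool => Nat.nth (fun i => a i = true) v := by
    refine measurable_to_countable' fun m => ?_
    have hset : (fun a : ℕ → Bool => Nat.nth (fun i => a i = true) v) ⁻¹' {m} =
        {a | (a m = true ∧ heads a m = v) ∨ (m = 0 ∧ ∀ k, ¬(a k = true ∧ heads a k = v))} :=
      ext fun a => nth_true_eq_iff a v m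
    rw [hset]
    exact (hnext m).union ((MeasurableSet.const _).inter hnone)
  exact (measurable_of_countable fun m : ℕ => m - v).comp hnth

lemma measurable_backJumps_uncurry : Measurable fun z : (ℕ → Bool) × ℕ => backJumps z.1 z.2 :=
  measurable_from_prod_countable_left measurable_backJumps

lemma backJumps_mono {a : ℕ → Bool} (ha : {i | a i = true}.Infinite) : Monotone (backJumps a) := by
  refine monotone_nat_of_le_succ fun v => ?_
  have hlt := Nat.nth_strictMono ha (Nat.lt_add_one v)
  unfold backJumps
  omega

lemma exists_lt_backJumps {a : ℕ → Bool} (ha : IsMixed a) (M : ℕ) : ∃ v, M < backJumps a v := by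
  set j := Nat.nth (fun i => (!a i) = true) (M + 1)
  have hfalse : heads (fun i => !a i) j = M + 1 := Nat.count_nth_of_infinite ha.not.1 _
  have hnth : j ≤ Nat.nth (fun i => a i = true) (heads a j) := Nat.le_nth_count ha.1 j
  rw [heads_not] at hfalse
  refine ⟨heads a j, ?_⟩
  unfold backJumps
  omega

lemma measurable_backwardChain (n : ℕ) : Measurable fun ω => backwardChain ω n := by
  induction n with
  | zero => exact measurable_const
  | succ n ih =>
    have htail : Measurable fun (ω : ℕ → ℕ → Bool) (x : ℕ) => ω (x + 1) := by fun_prop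
    exact measurable_backJumps_uncurry.comp ((measurable_pi_apply 0).prodMk (ih.comp htail))

lemma measurable_comp_backwardChain {β : Type*} [MeasurableSpace β] (g : ℕ → β) (n : ℕ) :
    Measurable fun ω => g (backwardChain ω n) :=
  (measurable_of_countable g).comp (measurable_backwardChain n)

lemma measurableSet_bddAbove_backwardChain :
    MeasurableSet {ω | BddAbove (range (backwardChain ω))} :=
  measurableSet_bddAbove_range measurable_backwardChain

section Monotone

variable {ω : ℕ → ℕ → Bool}

lemma backwardChain_mono (hω : ∀ x, {i | ω x i = true}.Infinite) : Monotone (backwardChain ω) := by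
  refine monotone_nat_of_le_succ fun n => ?_
  induction n generalizing ω with
  | zero => exact Nat.zero_le _
  | succ n ih => exact backJumps_mono (hω 0) (ih fun x => hω (x + 1))

lemma bddAbove_backwardChain_iff_tail (hω : IsMixed (ω 0)) :
    BddAbove (range (backwardChain ω)) ↔
      BddAbove (range (backwardChain fun x => ω (x + 1))) := by
  constructor
  · rintro ⟨M, hM⟩
    obtain ⟨v, hv⟩ := exists_lt_backJumps hω M
    refine ⟨v, forall_mem_range.2 fun n => le_of_not_gt fun hn => ?_⟩
    exact (hv.trans_le (backJumps_mono hω.1 hn.le)).not_ge (hM ⟨n + 1, rfl⟩)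
  · rintro ⟨M, hM⟩
    refine ⟨backJumps (ω 0) M, forall_mem_range.2 fun n => ?_⟩
    cases n with
    | zero => exact Nat.zero_le _
    | succ n => exact backJumps_mono hω.1 (hM ⟨n, rfl⟩)

lemma eventually_backwardChain_eq_iSup (hω : ∀ x, {i | ω x i = true}.Infinite)
    (hbdd : BddAbove (range (backwardChain ω))) :
    ∀ᶠ n in atTop, backwardChain ω n = ⨆ m, backwardChain ω m := by
  simpa [nhds_discrete] using tendsto_atTop_ciSup (backwardChain_mono hω) hbdd

end Monotone

lemma ae_forall_infinitePi {ι α : Type*} [Countable ι] [MeasurableSpace α] {ν : ι → Measure α}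
    [∀ x, IsProbabilityMeasure (ν x)] {P : α → Prop} (hP : ∀ x, ∀ᵐ a ∂ν x, P a) :
    ∀ᵐ ω ∂(Measure.infinitePi ν), ∀ x, P (ω x) :=
  ae_all_iff.2 fun x => (measurePreserving_eval_infinitePi ν x).quasiMeasurePreserving.ae (hP x)

section Chain

variable {p : ℕ → ℕ → ℝ} {ν : Measure (ℕ → Bool)} [IsProbabilityMeasure ν]

lemma setLIntegral_backwardChain_succ (hmix : ∀ᵐ a ∂ν, IsMixed a) {A : Set (ℕ → ℕ → Bool)}
    (hA : MeasurableSet A) (htail : ∀ ω : ℕ → ℕ → Bool, IsMixed (ω 0) →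
      (ω ∈ A ↔ (fun x => ω (x + 1)) ∈ A)) (g : ℕ → ENNReal) (n : ℕ) :
    ∫⁻ ω in A, g (backwardChain ω (n + 1)) ∂(Measure.infinitePi fun _ : ℕ => ν) =
      ∫⁻ ω in A, ∫⁻ a, g (backJumps a (backwardChain ω n)) ∂ν
        ∂(Measure.infinitePi fun _ : ℕ => ν) := by
  set step : (ℕ → Bool) → (ℕ → ℕ → Bool) → ENNReal := fun a =>
    A.indicator fun ω => g (backJumps a (backwardChain ω n)) with hstep
  have hmeas : Measurable (Function.uncurry step) :=
    Measurable.indicator (s := Prod.snd ⁻¹' A)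
      (f := fun z : (ℕ → Bool) × (ℕ → ℕ → Bool) => g (backJumps z.1 (backwardChain z.2 n)))
      ((measurable_of_countable g).comp (measurable_backJumps_uncurry.comp
        (measurable_fst.prodMk ((measurable_backwardChain n).comp measurable_snd))))
      (measurable_snd hA)
  rw [← lintegral_indicator hA, ← lintegral_indicator hA]
  calc ∫⁻ ω, A.indicator (fun ω => g (backwardChain ω (n + 1))) ω
        ∂(Measure.infinitePi fun _ : ℕ => ν)
    _ = ∫⁻ ω, step (ω 0) (fun x => ω (x + 1)) ∂(Measure.infinitePi fun _ : ℕ => ν) := by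
      refine lintegral_congr_ae ((ae_forall_infinitePi fun _ => hmix).mono fun ω hω => ?_)
      by_cases hmem : ω ∈ A
      · simp only [hstep, indicator_of_mem hmem, indicator_of_mem ((htail ω (hω 0)).1 hmem),
          backwardChain]
      · simp only [hstep, indicator_of_notMem hmem,
          indicator_of_notMem (mt (htail ω (hω 0)).2 hmem)]
    _ = ∫⁻ ω, ∫⁻ a, step a ω ∂ν ∂(Measure.infinitePi fun _ : ℕ => ν) := lintegral_head_tail ν hmeas
    _ = _ := by
      refine lintegral_congr fun ω => ?_
      by_cases hmem : ω ∈ A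
      · simp only [hstep, indicator_of_mem hmem]
      · simp only [hstep, indicator_of_notMem hmem, lintegral_zero]

lemma tendsto_setLIntegral_backwardChain (hinf : ∀ᵐ a ∂ν, {i | a i = true}.Infinite)
    {g : ℕ → ENNReal} {C : ENNReal} (hC : C ≠ ⊤) (hg : ∀ v, g v ≤ C) :
    Tendsto (fun n => ∫⁻ ω in {ω | BddAbove (range (backwardChain ω))}, g (backwardChain ω n)
        ∂(Measure.infinitePi fun _ : ℕ => ν)) atTop
      (𝓝 (∫⁻ ω in {ω | BddAbove (range (backwardChain ω))}, g (⨆ m, backwardChain ω m)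
        ∂(Measure.infinitePi fun _ : ℕ => ν))) := by
  refine tendsto_lintegral_of_dominated_convergence (fun _ => C)
    (measurable_comp_backwardChain g) (fun n => Eventually.of_forall fun ω => hg _) ?_ ?_
  · rw [lintegral_const]
    exact ENNReal.mul_ne_top hC (measure_ne_top _ _)
  · filter_upwards [ae_restrict_of_ae (ae_forall_infinitePi fun _ => hinf),
      ae_restrict_mem measurableSet_bddAbove_backwardChain] with ω hω hbdd
    exact tendsto_const_nhds.congr' ((eventually_backwardChain_eq_iSup hω hbdd).mono
      fun n hn => (congrArg g hn).symm)

lemma setLIntegral_iSup_backwardChain_le (hmix : ∀ᵐ a ∂ν, IsMixed a) {g h : ℕ → ENNReal}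
    {C : ENNReal} (hC : C ≠ ⊤) (hg : ∀ v, g v ≤ C) (hh : ∀ v, h v ≤ C)
    (hstep : ∀ v, ∫⁻ a, g (backJumps a v) ∂ν ≤ h v) :
    ∫⁻ ω in {ω | BddAbove (range (backwardChain ω))}, g (⨆ m, backwardChain ω m)
        ∂(Measure.infinitePi fun _ : ℕ => ν) ≤
      ∫⁻ ω in {ω | BddAbove (range (backwardChain ω))}, h (⨆ m, backwardChain ω m)
        ∂(Measure.infinitePi fun _ : ℕ => ν) := by
  have hinf : ∀ᵐ a ∂ν, {i | a i = true}.Infinite := hmix.mono fun _ => And.left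
  refine le_of_tendsto_of_tendsto' ((tendsto_setLIntegral_backwardChain hinf hC hg).comp
    (tendsto_add_atTop_nat 1)) (tendsto_setLIntegral_backwardChain hinf hC hh) fun n => ?_
  rw [Function.comp_apply, setLIntegral_backwardChain_succ hmix
    measurableSet_bddAbove_backwardChain fun ω => bddAbove_backwardChain_iff_tail]
  exact lintegral_mono fun ω => hstep _

end Chain

lemma abs_inv_pow_sub_pow_le {ε : ℝ} (h0 : 0 < ε) (h1 : ε < 1) (v : ℕ) :
    |((1 + ε) ^ (v + 1))⁻¹ - (1 - ε) ^ v| ≤ ε := by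
  have hpos : 0 < (1 + ε) ^ v := by positivity
  have : 0 ≤ (1 - ε) ^ v := pow_nonneg (by linarith) _
  have hle : (1 - ε) ^ v ≤ 1 := pow_le_one₀ (by linarith) (by linarith)
  have hmul : (1 - ε) ^ v * (1 + ε) ^ v = (1 + -ε ^ 2) ^ v := by rw [← mul_pow]; ring_nf
  have hlower : (1 - ε) ^ (v + 1) ≤ ((1 + ε) ^ (v + 1))⁻¹ := by
    rw [← inv_pow]
    refine pow_le_pow_left₀ (by linarith) ?_ _
    rw [← one_div, le_div_iff₀ (by linarith)]
    nlinarith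
  have hupper : ((1 + ε) ^ v)⁻¹ ≤ ε + (1 - ε) ^ v := by
    have hsub : 1 + (v : ℝ) * -ε ^ 2 ≤ (1 + -ε ^ 2) ^ v := one_add_mul_le_pow (by nlinarith) v
    have hadd : 1 + (v : ℝ) * ε ≤ (1 + ε) ^ v := one_add_mul_le_pow (by linarith) v
    rw [← one_div, div_le_iff₀ hpos, add_mul, hmul]
    nlinarith
  have hanti : ((1 + ε) ^ (v + 1))⁻¹ ≤ ((1 + ε) ^ v)⁻¹ :=
    inv_anti₀ hpos (pow_le_pow_right₀ (by linarith) v.le_succ)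
  rw [pow_succ] at hlower
  rw [abs_le]
  constructor <;> nlinarith

lemma tendsto_inv_pow_sub_pow_div (v : ℕ) :
    Tendsto (fun ε : ℝ => (((1 + ε) ^ (v + 1))⁻¹ - (1 - ε) ^ v) / ε) (𝓝[>] 0) (𝓝 (-1)) := by
  have hadd : HasDerivAt (fun x : ℝ => (1 + x) ^ (v + 1)) (((v + 1 : ℕ) : ℝ)) 0 := by
    simpa using ((hasDerivAt_id (0 : ℝ)).const_add 1).fun_pow (v + 1)
  have hsub : HasDerivAt (fun x : ℝ => (1 - x) ^ v) (-(v : ℝ)) 0 := by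
    simpa using ((hasDerivAt_id (0 : ℝ)).const_sub 1).fun_pow v
  have hderiv : HasDerivAt (fun x : ℝ => ((1 + x) ^ (v + 1))⁻¹ - (1 - x) ^ v) (-1) 0 :=
    ((hadd.fun_inv (by simp)).fun_sub hsub).congr_deriv (by simp)
  simpa [div_eq_inv_mul] using hderiv.tendsto_slope_zero_right

lemma tendsto_integral_inv_pow_sub_pow_div (m : Measure ℕ) [IsFiniteMeasure m] :
    Tendsto (fun ε : ℝ => ∫ v, (((1 + ε) ^ (v + 1))⁻¹ - (1 - ε) ^ v) / ε ∂m) (𝓝[>] 0)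
      (𝓝 (∫ _, -1 ∂m)) := by
  refine tendsto_integral_filter_of_dominated_convergence (fun _ => 1)
    (Eventually.of_forall fun ε => (measurable_of_countable _).aestronglyMeasurable) ?_
    (integrable_const _) (Eventually.of_forall tendsto_inv_pow_sub_pow_div)
  filter_upwards [Ioo_mem_nhdsGT one_pos] with ε hε
  refine Eventually.of_forall fun v => ?_
  rw [Real.norm_eq_abs, abs_div, abs_of_pos hε.1]
  exact (div_le_one hε.1).2 (abs_inv_pow_sub_pow_le hε.1 hε.2 v)

/- To first order in `ε`, the inequality `hm` reads `∫ (1 - d) ∂m ≤ 0`. -/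
lemma measure_eq_zero_of_integral_pow_le {m : Measure ℕ} [IsFiniteMeasure m] {d : ℕ → ℝ}
    (hd : ∀ v, d v ∈ Ico (0 : ℝ) 1)
    (hm : ∀ ε ∈ Ioo (0 : ℝ) 1,
      ∫ v, (1 - ε) ^ v ∂m ≤ ∫ v, (((1 + ε) ^ (v + 1))⁻¹ + ε * d v) ∂m) : m = 0 := by
  have hint : ∀ {g : ℕ → ℝ}, (∀ v, g v ∈ Icc (0 : ℝ) 1) → Integrable g m := fun hg =>
    .of_mem_Icc 0 1 (measurable_of_countable _).aemeasurable (Eventually.of_forall hg)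
  have hdint : Integrable d m := hint fun v => ⟨(hd v).1, (hd v).2.le⟩
  have hnonneg : ∀ᶠ ε : ℝ in 𝓝[>] 0,
      0 ≤ ∫ v, (((1 + ε) ^ (v + 1))⁻¹ - (1 - ε) ^ v) / ε ∂m + ∫ v, d v ∂m := by
    filter_upwards [Ioo_mem_nhdsGT one_pos] with ε hε
    have hinv : Integrable (fun v : ℕ => ((1 + ε) ^ (v + 1))⁻¹) m := hint fun v =>
      ⟨inv_nonneg.2 (pow_nonneg (by linarith [hε.1]) _),
        inv_le_one_of_one_le₀ (one_le_pow₀ (by linarith [hε.1]))⟩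
    have hpow : Integrable (fun v : ℕ => (1 - ε) ^ v) m := hint fun v =>
      ⟨pow_nonneg (by linarith [hε.2]) _,
        pow_le_one₀ (by linarith [hε.2]) (by linarith [hε.1])⟩
    have hle := hm ε hε
    rw [integral_add hinv (hdint.const_mul ε), integral_const_mul] at hle
    rw [integral_div, integral_sub hinv hpow, div_add' _ _ _ hε.1.ne']
    exact div_nonneg (by linarith) hε.1.le
  have hle : 0 ≤ ∫ _, -1 ∂m + ∫ v, d v ∂m :=
    ge_of_tendsto ((tendsto_integral_inv_pow_sub_pow_div m).add_const _) hnonneg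
  have hsub : 0 ≤ -∫ v, (1 - d v) ∂m := by
    rwa [integral_sub (integrable_const _) hdint, neg_sub', ← integral_neg, sub_neg_eq_add]
  have hsupport : Function.support (fun v => 1 - d v) = univ :=
    eq_univ_of_forall fun v => (sub_pos.2 (hd v).2).ne'
  have hpos := integral_pos_iff_support_of_nonneg (μ := m) (fun v => sub_nonneg.2 (hd v).2.le)
    ((integrable_const _).sub hdint)
  rw [hsupport] at hpos
  by_contra hne
  exact (hpos.2 (Measure.measure_univ_pos.2 hne)).not_ge (neg_nonneg.1 hsub)

/- If `D` stayed above `r > m`, then `a` would eventually decrease by `r - m` at each step. -/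
lemma liminf_le_of_add_le {a D : ℕ → ENNReal} {m : ENNReal} (ha : a 0 ≠ ⊤) (hm : m ≠ ⊤)
    (hstep : ∀ n, a (n + 1) + D n ≤ a n + m) : liminf D atTop ≤ m := by
  by_contra! hlt
  obtain ⟨r, hmr, hr⟩ := exists_between hlt
  obtain ⟨N, hN⟩ := eventually_atTop.1 (eventually_lt_of_lt_liminf hr)
  have hfin : ∀ n, a n ≠ ⊤ := fun n => by
    induction n with
    | zero => exact ha
    | succ n ih =>
      exact ne_top_of_le_ne_top (ENNReal.add_ne_top.2 ⟨ih, hm⟩) (le_self_add.trans (hstep n))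
  have hdecr : ∀ n ≥ N, a (n + 1) + (r - m) ≤ a n := fun n hn => by
    rw [← ENNReal.add_le_add_iff_right hm, add_assoc, tsub_add_cancel_of_le hmr.le]
    exact (add_le_add_right (hN n hn).le _).trans (hstep n)
  have hiter : ∀ k : ℕ, a (N + k) + k * (r - m) ≤ a N := fun k => by
    induction k with
    | zero => simp
    | succ k ih =>
      calc a (N + (k + 1)) + (k + 1 : ℕ) * (r - m)
        _ = a (N + k + 1) + (r - m) + k * (r - m) := by push_cast; ring_nf
        _ ≤ a (N + k) + k * (r - m) := by gcongr; exact hdecr _ (by omega)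
        _ ≤ a N := ih
  obtain ⟨k, hk⟩ := ENNReal.exists_nat_mul_gt (tsub_pos_of_lt hmr).ne' (hfin N)
  exact (le_add_self.trans (hiter k)).not_gt hk

section Chain

variable {p : ℕ → ℕ → ℝ} {ν : Measure (ℕ → Bool)} [IsProbabilityMeasure ν]

lemma setIntegral_pow_iSup_backwardChain_le (hν : IsUrnLaw p ν) (hmix : ∀ᵐ a ∂ν, IsMixed a)
    (hp : ∀ c i, p c i ∈ Icc (0 : ℝ) 1) (hdrift : ∀ v, siteDrift p ν v ≤ 1) {ε : ℝ}
    (hε : ε ∈ Icc (0 : ℝ) 1) :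
    ∫ ω in {ω | BddAbove (range (backwardChain ω))}, (1 - ε) ^ (⨆ m, backwardChain ω m)
        ∂(Measure.infinitePi fun _ : ℕ => ν) ≤
      ∫ ω in {ω | BddAbove (range (backwardChain ω))},
        (((1 + ε) ^ ((⨆ m, backwardChain ω m) + 1))⁻¹ +
          ε * (siteDrift p ν (⨆ m, backwardChain ω m)).toReal)
        ∂(Measure.infinitePi fun _ : ℕ => ν) := by
  have hpow : ∀ v : ℕ, (1 - ε) ^ v ∈ Icc (0 : ℝ) 1 := fun v =>
    ⟨pow_nonneg (by linarith [hε.2]) _, pow_le_one₀ (by linarith [hε.2]) (by linarith [hε.1])⟩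
  have hinv : ∀ v : ℕ, ((1 + ε) ^ (v + 1))⁻¹ ∈ Icc (0 : ℝ) 1 := fun v =>
    ⟨inv_nonneg.2 (pow_nonneg (by linarith [hε.1]) _),
      inv_le_one_of_one_le₀ (one_le_pow₀ (by linarith [hε.1]))⟩
  have hmul : ∀ v, ε * (siteDrift p ν v).toReal ∈ Icc (0 : ℝ) 1 := fun v =>
    ⟨mul_nonneg hε.1 ENNReal.toReal_nonneg, mul_le_one₀ hε.2 ENNReal.toReal_nonneg
      (ENNReal.toReal_le_of_le_ofReal zero_le_one (by simpa using hdrift v))⟩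
  have hmeas : ∀ g : ℕ → ℝ, AEStronglyMeasurable (fun ω => g (⨆ m, backwardChain ω m))
      ((Measure.infinitePi fun _ : ℕ => ν).restrict {ω | BddAbove (range (backwardChain ω))}) :=
    fun g => ((measurable_of_countable g).comp
      (Measurable.iSup measurable_backwardChain)).aestronglyMeasurable
  have hle := setLIntegral_iSup_backwardChain_le hmix (C := ENNReal.ofReal 2)
    (g := fun v => ENNReal.ofReal ((1 - ε) ^ v))
    (h := fun v => ENNReal.ofReal (((1 + ε) ^ (v + 1))⁻¹ + ε * (siteDrift p ν v).toReal))
    ENNReal.ofReal_ne_top (fun v => ENNReal.ofReal_le_ofReal (by linarith [(hpow v).2]))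
    (fun v => ENNReal.ofReal_le_ofReal (by linarith [(hinv v).2, (hmul v).2])) fun v => by
      rw [ENNReal.ofReal_add (hinv v).1 (hmul v).1, ENNReal.ofReal_mul hε.1,
        ENNReal.ofReal_toReal (ne_top_of_le_ne_top ENNReal.one_ne_top (hdrift v))]
      exact lintegral_pow_backJumps_le hν hp hε v (hmix.mono fun _ => And.left)
  rw [integral_eq_lintegral_of_nonneg_ae (Eventually.of_forall fun ω => (hpow _).1)
      (hmeas fun v => (1 - ε) ^ v),
    integral_eq_lintegral_of_nonneg_ae
      (Eventually.of_forall fun ω => add_nonneg (hinv _).1 (hmul _).1)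
      (hmeas fun v => ((1 + ε) ^ (v + 1))⁻¹ + ε * (siteDrift p ν v).toReal)]
  refine ENNReal.toReal_mono (ne_top_of_le_ne_top ?_ (lintegral_mono fun ω =>
    ENNReal.ofReal_le_ofReal (by linarith [(hinv (⨆ m, backwardChain ω m)).2,
      (hmul (⨆ m, backwardChain ω m)).2]) : _ ≤ ∫⁻ _, ENNReal.ofReal 2 ∂_)) hle
  rw [lintegral_const]
  exact ENNReal.mul_ne_top ENNReal.ofReal_ne_top (measure_ne_top _ _)

lemma ae_not_bddAbove_backwardChain (hν : IsUrnLaw p ν) (hmix : ∀ᵐ a ∂ν, IsMixed a)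
    (hp : ∀ c i, p c i ∈ Icc (0 : ℝ) 1) (hdrift : ∀ v, siteDrift p ν v < 1) :
    ∀ᵐ ω ∂(Measure.infinitePi fun _ : ℕ => ν), ¬BddAbove (range (backwardChain ω)) := by
  set B := {ω | BddAbove (range (backwardChain ω))}
  set limitLaw := ((Measure.infinitePi fun _ : ℕ => ν).restrict B).map
    fun ω => ⨆ m, backwardChain ω m with hlimit
  set d : ℕ → ℝ := fun v => (siteDrift p ν v).toReal
  have hd : ∀ v, d v ∈ Ico (0 : ℝ) 1 := fun v =>
    ⟨ENNReal.toReal_nonneg, by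
      simpa using (ENNReal.toReal_lt_toReal (hdrift v).ne_top ENNReal.one_ne_top).2 (hdrift v)⟩
  have hmeas : AEMeasurable (fun ω => ⨆ m, backwardChain ω m)
      ((Measure.infinitePi fun _ : ℕ => ν).restrict B) :=
    (Measurable.iSup measurable_backwardChain).aemeasurable
  have hzero : limitLaw = 0 := by
    refine measure_eq_zero_of_integral_pow_le hd fun ε hε => ?_
    rw [hlimit, integral_map hmeas (measurable_of_countable _).aestronglyMeasurable,
      integral_map hmeas (measurable_of_countable _).aestronglyMeasurable]
    exact setIntegral_pow_iSup_backwardChain_le hν hmix hp (fun v => (hdrift v).le)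
      (Ioo_subset_Icc_self hε)
  rw [hlimit, Measure.map_eq_zero_iff hmeas,
    Measure.restrict_eq_zero] at hzero
  exact measure_eq_zero_iff_ae_notMem.1 hzero

lemma ae_bddAbove_backwardChain (hν : IsUrnLaw p ν) (hmix : ∀ᵐ a ∂ν, IsMixed a)
    (hp : ∀ c i, p c i ∈ Icc (1 / 2 : ℝ) 1) (hdrift : 1 < totalDrift p ν) :
    ∀ᵐ ω ∂(Measure.infinitePi fun _ : ℕ => ν), BddAbove (range (backwardChain ω)) := by
  set μ := Measure.infinitePi fun _ : ℕ => ν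
  set A : Set (ℕ → ℕ → Bool) := {ω | BddAbove (range (backwardChain ω))}ᶜ
  have hA : MeasurableSet A := measurableSet_bddAbove_backwardChain.compl
  have hinf : ∀ᵐ a ∂ν, {i | a i = true}.Infinite := hmix.mono fun _ => And.left
  have hstep : ∀ n, ∫⁻ ω in A, (backwardChain ω (n + 1) : ENNReal) ∂μ +
      ∫⁻ ω in A, siteDrift p ν (backwardChain ω n) ∂μ =
        ∫⁻ ω in A, (backwardChain ω n : ENNReal) ∂μ + μ A := fun n => by
    rw [setLIntegral_backwardChain_succ hmix hA
        (fun ω hω => not_congr (bddAbove_backwardChain_iff_tail hω)) (fun v => (v : ENNReal)) n,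
      ← lintegral_add_right _ (measurable_comp_backwardChain _ n)]
    simp_rw [lintegral_backJumps_add_siteDrift hν hinf hp]
    rw [lintegral_add_left (measurable_comp_backwardChain (fun v => (v : ENNReal)) n),
      setLIntegral_one]
  obtain ⟨v, hv⟩ := exists_lt_siteDrift hdrift
  have hdrift_le : siteDrift p ν v * μ A ≤ μ A :=
    calc siteDrift p ν v * μ A = ∫⁻ _ in A, siteDrift p ν v ∂μ := (setLIntegral_const _ _).symm
      _ ≤ ∫⁻ ω in A, liminf (fun n => siteDrift p ν (backwardChain ω n)) atTop ∂μ := by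
        refine lintegral_mono_ae ?_
        filter_upwards [ae_restrict_of_ae (ae_forall_infinitePi fun _ => hinf),
          ae_restrict_mem hA] with ω hω hunb
        refine le_liminf_of_le (by isBoundedDefault) ?_
        filter_upwards [(tendsto_atTop_atTop_of_monotone' (backwardChain_mono hω)
          hunb).eventually_ge_atTop v] with n hn
        exact siteDrift_mono p ν hn
      _ ≤ liminf (fun n => ∫⁻ ω in A, siteDrift p ν (backwardChain ω n) ∂μ) atTop :=
        lintegral_liminf_le fun n => measurable_comp_backwardChain _ n
      _ ≤ μ A := liminf_le_of_add_le (a := fun n => ∫⁻ ω in A, (backwardChain ω n : ENNReal) ∂μ)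
        (by simp [backwardChain]) (measure_ne_top _ _) fun n => (hstep n).le
  have hzero : μ A = 0 := by
    by_contra hne
    refine hdrift_le.not_gt ?_
    simpa using ENNReal.mul_lt_mul_left hne (measure_ne_top _ _) hv
  exact mem_ae_iff.2 hzero

end Chain

/-! ### Comparison of urns -/

lemma heads_const_true (j : ℕ) : heads (fun _ => true) j = j := by simp [heads]

lemma lintegral_heads_urnLaw (p : ℕ → ℕ → ℝ) (g : ℕ → ENNReal) (j : ℕ) :
    ∫⁻ a, g (heads a j) ∂urnLaw p = ∫⁻ u, g (urnHeads p u j)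
      ∂(Measure.infinitePi fun _ : ℕ => (volume : Measure unitInterval)) := by
  rw [urnLaw, lintegral_map (measurable_comp_heads g j) (measurable_urnDraws p)]
  simp_rw [heads_urnDraws]

lemma urnHeads_le_urnHeads {p q : ℕ → ℕ → ℝ} (hpq : ∀ c c' i, c ≤ c' → p c i ≤ q c' i)
    (u : ℕ → unitInterval) (i : ℕ) : urnHeads p u i ≤ urnHeads q u i := by
  induction i with
  | zero => exact le_rfl
  | succ i ih =>
    rw [urnHeads, urnHeads]
    by_cases hu : (u i : ℝ) ≤ p (urnHeads p u i) i
    · rw [if_pos hu, if_pos (hu.trans (hpq _ _ i ih))]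
      omega
    · rw [if_neg hu]
      omega

lemma totalDrift_mono {p q : ℕ → ℕ → ℝ} (hpq : ∀ c c' i, c ≤ c' → p c i ≤ q c' i) :
    totalDrift p (urnLaw p) ≤ totalDrift q (urnLaw q) := by
  refine ENNReal.tsum_le_tsum fun j => ?_
  rw [lintegral_heads_urnLaw p fun c => posDrift p c j,
    lintegral_heads_urnLaw q fun c => posDrift q c j]
  refine lintegral_mono fun u => ENNReal.ofReal_le_ofReal ?_
  linarith [hpq _ _ j (urnHeads_le_urnHeads hpq u j)]

lemma mul_measure_prefix_true_le_lintegral_heads (ν : Measure (ℕ → Bool)) (g : ℕ → ENNReal)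
    (j : ℕ) : g j * ν {a | ∀ i < j, a i = true} ≤ ∫⁻ a, g (heads a j) ∂ν := by
  rw [← lintegral_indicator_const (measurableSet_prefix (fun _ => true) j)]
  refine lintegral_mono fun a => indicator_apply_le'
    (fun ha : ∀ i < j, a i = true => ?_) fun _ => zero_le
  rw [heads_congr ha, heads_const_true]

section PrefixTrue

variable {p : ℕ → ℕ → ℝ}

lemma urnLaw_prefix_true (hp : ∀ c i, p c i ∈ Icc (0 : ℝ) 1) (j : ℕ) :
    urnLaw p {a | ∀ i < j, a i = true} = ∏ i ∈ Finset.range j, ENNReal.ofReal (p i i) := by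
  simp [urnLaw_prefix hp fun _ => true, heads_const_true, drawProb]

lemma posDrift_mul_prod_le_lintegral (hp : ∀ c i, p c i ∈ Icc (0 : ℝ) 1) (j : ℕ) :
    posDrift p j j * ∏ i ∈ Finset.range j, ENNReal.ofReal (p i i) ≤
      ∫⁻ a, posDrift p (heads a j) j ∂urnLaw p := by
  rw [← urnLaw_prefix_true hp]
  exact mul_measure_prefix_true_le_lintegral_heads _ (fun c => posDrift p c j) j

lemma siteDrift_lt_totalDrift (hp : ∀ c i, p c i ∈ Ioc (0 : ℝ) 1)
    (hfin : totalDrift p (urnLaw p) ≠ ⊤) {v j : ℕ} (hvj : v < j) (hj : 1 / 2 < p j j) :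
    siteDrift p (urnLaw p) v < totalDrift p (urnLaw p) := by
  have hpos : 0 < ∫⁻ a, (if v < heads a j then posDrift p (heads a j) j else 0) ∂urnLaw p := by
    refine lt_of_lt_of_le (ENNReal.mul_pos ?_ ?_) (mul_measure_prefix_true_le_lintegral_heads _
      (fun c => if v < c then posDrift p c j else 0) j)
    · rw [if_pos hvj, posDrift]
      exact (ENNReal.ofReal_pos.2 (by linarith)).ne'
    · rw [urnLaw_prefix_true fun c i => Ioc_subset_Icc_self (hp c i)]
      exact Finset.prod_ne_zero_iff.2 fun i _ => (ENNReal.ofReal_pos.2 (hp i i).1).ne'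
  have hle := siteDrift_add_le p (urnLaw p) v j
  exact (ENNReal.lt_add_right (ne_top_of_le_ne_top hfin (le_self_add.trans hle)) hpos.ne').trans_le
    hle

end PrefixTrue

section Continuity

variable {T : Type*} [TopologicalSpace T] {p : T → ℕ → ℕ → ℝ} {t : T}

lemma continuousAt_lintegral_posDrift (hp : ∀ s c i, p s c i ∈ Icc (0 : ℝ) 1)
    (hcont : ∀ c i, ContinuousAt (fun s => p s c i) t) (j : ℕ) :
    ContinuousAt (fun s => ∫⁻ a, posDrift (p s) (heads a j) j ∂urnLaw (p s)) t := by
  have hdrift : ∀ c, ContinuousAt (fun s => posDrift (p s) c j) t := fun c =>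
    ENNReal.continuous_ofReal.continuousAt.comp
      (((hcont c j).const_mul 2).sub tendsto_const_nhds)
  have hdraw : ∀ c i x, ContinuousAt (fun s => drawProb (p s) c i x) t := fun c i x => by
    refine ENNReal.continuous_ofReal.continuousAt.comp ?_
    cases x
    exacts [tendsto_const_nhds.sub (hcont c i), hcont c i]
  have hfinite : ∀ s, ∫⁻ a, posDrift (p s) (heads a j) j ∂urnLaw (p s) =
      ∑ b : Fin j → Bool, posDrift (p s) (heads (extendBool b) j) j *
        ∏ i ∈ Finset.range j, drawProb (p s) (heads (extendBool b) i) i (extendBool b i) := by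
    intro s
    rw [lintegral_eq_sum_prefix _ (m := j) fun a b hab => by rw [heads_congr hab]]
    simp_rw [urnLaw_prefix (hp s)]
  have hprod : ∀ (s : T) (b : ℕ → Bool),
      ∏ i ∈ Finset.range j, drawProb (p s) (heads b i) i (b i) ≠ ⊤ := fun s b =>
    ENNReal.prod_ne_top fun i _ => ENNReal.ofReal_ne_top
  simp_rw [hfinite]
  exact tendsto_finsetSum _ fun b _ => ENNReal.Tendsto.mul (hdrift _) (.inr (hprod t _))
    (ENNReal.tendsto_finsetProd_of_ne_top _ (fun i _ => hdraw _ i _)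
      fun i _ => ENNReal.ofReal_ne_top) (.inr ENNReal.ofReal_ne_top)

lemma eventually_lt_totalDrift (hp : ∀ s c i, p s c i ∈ Icc (0 : ℝ) 1)
    (hcont : ∀ c i, ContinuousAt (fun s => p s c i) t) {r : ENNReal}
    (hr : r < totalDrift (p t) (urnLaw (p t))) :
    ∀ᶠ s in 𝓝 t, r < totalDrift (p s) (urnLaw (p s)) := by
  rw [totalDrift, ENNReal.tsum_eq_iSup_nat, lt_iSup_iff] at hr
  obtain ⟨m, hm⟩ := hr
  have hsum : ContinuousAt (fun s => ∑ j ∈ Finset.range m,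
      ∫⁻ a, posDrift (p s) (heads a j) j ∂urnLaw (p s)) t :=
    tendsto_finsetSum _ fun j _ => continuousAt_lintegral_posDrift hp hcont j
  exact (hsum.eventually_const_lt hm).mono fun s hs => hs.trans_le (ENNReal.sum_le_tsum _)

end Continuity

lemma IsUrnLaw.lintegral_pow_tails_le {p : ℕ → ℕ → ℝ} {ν : Measure (ℕ → Bool)}
    [IsProbabilityMeasure ν] (hν : IsUrnLaw p ν) {q s : ℝ} (hp : ∀ c i, p c i ∈ Icc (0 : ℝ) q)
    (hq : q ≤ 1) (hs : s ∈ Icc (0 : ℝ) 1) (j : ℕ) :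
    ∫⁻ a, ENNReal.ofReal (s ^ (j - heads a j)) ∂ν ≤ ENNReal.ofReal ((q + (1 - q) * s) ^ j) := by
  have hq0 : 0 ≤ q := (hp 0 0).1.trans (hp 0 0).2
  have hr : 0 ≤ q + (1 - q) * s := add_nonneg hq0 (mul_nonneg (by linarith) hs.1)
  induction j with
  | zero => simp
  | succ j ih =>
    have hsucc : ∀ a : ℕ → Bool, ENNReal.ofReal (s ^ (j + 1 - heads a (j + 1))) =
        ENNReal.ofReal (s ^ (j + 1 - (heads a j + if a j then 1 else 0))) := fun a => by
      rw [heads_succ]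
    have hdraw : ∀ a : ℕ → Bool, ENNReal.ofReal (p (heads a j) j) *
          ENNReal.ofReal (s ^ (j + 1 - (heads a j + if true then 1 else 0))) +
        ENNReal.ofReal (1 - p (heads a j) j) *
          ENNReal.ofReal (s ^ (j + 1 - (heads a j + if false then 1 else 0))) ≤
        ENNReal.ofReal (q + (1 - q) * s) * ENNReal.ofReal (s ^ (j - heads a j)) := fun a => by
      have hpj := hp (heads a j) j
      have hpow : ∀ k : ℕ, 0 ≤ s ^ k := fun k => pow_nonneg hs.1 k
      rw [← ENNReal.ofReal_mul hpj.1, ← ENNReal.ofReal_mul (by linarith [hpj.2]),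
        ← ENNReal.ofReal_mul hr, ← ENNReal.ofReal_add (mul_nonneg hpj.1 (hpow _))
          (mul_nonneg (by linarith [hpj.2]) (hpow _))]
      refine ENNReal.ofReal_le_ofReal ?_
      rw [if_pos rfl, if_neg Bool.false_ne_true, add_zero, Nat.add_sub_add_right,
        Nat.sub_add_comm (heads_le a j), pow_succ]
      nlinarith [mul_nonneg (mul_nonneg (sub_nonneg.2 hpj.2) (sub_nonneg.2 hs.2))
        (hpow (j - heads a j))]
    rw [lintegral_congr hsucc, hν.lintegral_heads_apply j fun c x =>
      ENNReal.ofReal (s ^ (j + 1 - (c + if x then 1 else 0)))]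
    refine (lintegral_mono hdraw).trans ?_
    rw [lintegral_const_mul' _ _ ENNReal.ofReal_ne_top, pow_succ', ENNReal.ofReal_mul hr]
    gcongr

/-! ### The plateau urn function -/

/-- A smooth nondecreasing urn function, equal to `1 / 2` on `[0, 19 / 20]` and to `9 / 10` on
`[39 / 40, 1]`, whose graph meets the diagonal only at `1 / 2`. -/
noncomputable def plateau (x : ℝ) : ℝ := 1 / 2 + 2 / 5 * Real.smoothTransition (40 * (x - 19 / 20))

lemma half_le_plateau (x : ℝ) : 1 / 2 ≤ plateau x := by
  rw [plateau]
  linarith [Real.smoothTransition.nonneg (40 * (x - 19 / 20))]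

lemma plateau_le (x : ℝ) : plateau x ≤ 9 / 10 := by
  rw [plateau]
  linarith [Real.smoothTransition.le_one (40 * (x - 19 / 20))]

lemma plateau_of_le {x : ℝ} (hx : x ≤ 19 / 20) : plateau x = 1 / 2 := by
  rw [plateau, Real.smoothTransition.zero_of_nonpos (by linarith)]
  norm_num

lemma plateau_of_ge {x : ℝ} (hx : 39 / 40 ≤ x) : plateau x = 9 / 10 := by
  rw [plateau, Real.smoothTransition.one_of_one_le (by linarith)]
  norm_num

lemma half_lt_plateau {x : ℝ} (hx : 19 / 20 < x) : 1 / 2 < plateau x := by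
  rw [plateau]
  linarith [Real.smoothTransition.pos_of_pos (x := 40 * (x - 19 / 20)) (by linarith)]

lemma plateau_monotone : Monotone plateau := fun x y hxy => by
  rw [plateau, plateau]
  linarith [Real.smoothTransition.monotone (a := 40 * (x - 19 / 20)) (b := 40 * (y - 19 / 20))
    (by linarith)]

lemma contDiff_plateau {n : ℕ∞} : ContDiff ℝ n plateau :=
  contDiff_const.add (contDiff_const.mul
    (Real.smoothTransition.contDiff.comp (contDiff_const.mul (contDiff_id.sub contDiff_const))))

lemma plateau_mem_Icc (x : ℝ) : plateau x ∈ Icc (0 : ℝ) 1 :=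
  ⟨by linarith [half_le_plateau x], by linarith [plateau_le x]⟩

lemma plateau_eq_self_iff {x : ℝ} : plateau x = x ↔ x = 1 / 2 := by
  refine ⟨fun hfix => ?_, ?_⟩
  · by_cases hx : x ≤ 19 / 20
    · rw [← hfix, plateau_of_le hx]
    · linarith [plateau_le x]
  · rintro rfl
    exact plateau_of_le (by norm_num)

lemma isUrnFunction_plateau : IsUrnFunction plateau where
  contDiffOn := (contDiff_plateau (n := 3)).contDiffOn
  mapsTo x _ := ⟨by linarith [half_le_plateau x], by linarith [plateau_le x]⟩
  isolated p _ hp := by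
    filter_upwards [self_mem_nhdsWithin] with x hx _ hfix
    exact hx ((plateau_eq_self_iff.1 hfix).trans (plateau_eq_self_iff.1 hp).symm)

lemma isStableFixedPoint_plateau_iff (p : ℝ) : IsStableFixedPoint plateau p ↔ p = 1 / 2 := by
  refine ⟨fun hp => plateau_eq_self_iff.1 hp.2.1, ?_⟩
  rintro rfl
  have hconst : plateau =ᶠ[𝓝[Icc 0 1] (1 / 2)] fun _ => 1 / 2 :=
    eventually_nhdsWithin_of_eventually_nhds
      ((eventually_le_nhds (by norm_num : (1 / 2 : ℝ) < 19 / 20)).mono fun x => plateau_of_le)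
  refine ⟨by constructor <;> norm_num, plateau_eq_self_iff.2 rfl, ?_⟩
  rw [hconst.derivWithin_eq (plateau_eq_self_iff.2 rfl), derivWithin_fun_const]
  exact zero_le_one

/-! ### The drift of the plateau urn -/

/-- The expected total drift of a site whose initial urn is `(1 / 2, l)`, for the urn function
`plateau`. -/
noncomputable def plateauDrift (l : ℝ) : ENNReal :=
  totalDrift (urnProb plateau (1 / 2, l)) (urnLaw (urnProb plateau (1 / 2, l)))

lemma urnProb_plateau_mem_Icc (l : ℝ) (c i : ℕ) :
    urnProb plateau (1 / 2, l) c i ∈ Icc (0 : ℝ) 1 :=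
  plateau_mem_Icc _

lemma ae_isMixed_urnLaw_plateau (l : ℝ) :
    ∀ᵐ a ∂urnLaw (urnProb plateau (1 / 2, l)), IsMixed a :=
  ae_isMixed_urnLaw (q := 1 / 10) (by norm_num)
    (fun _ _ => (by norm_num : (1 / 10 : ℝ) ≤ 1 / 2).trans (half_le_plateau _))
    fun _ _ => (plateau_le _).trans_eq (by norm_num)

lemma plateauDrift_antitoneOn : AntitoneOn plateauDrift (Ioi 0) := by
  intro l (hl : 0 < l) l' _ hll'
  refine totalDrift_mono fun c c' i hc => ?_
  have : (0 : ℝ) ≤ i := i.cast_nonneg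
  have hcc' : (c : ℝ) ≤ c' := Nat.cast_le.2 hc
  simp only [urnProb]
  by_cases hhalf : (c : ℝ) ≤ i / 2
  · rw [plateau_of_le]
    · exact half_le_plateau _
    · rw [div_le_iff₀ (by linarith)]
      linarith
  · refine plateau_monotone ?_
    rw [div_le_div_iff₀ (by linarith) (by linarith)]
    nlinarith [mul_nonneg (sub_nonneg.2 hll') (sub_nonneg.2 (not_le.1 hhalf).le),
      mul_nonneg (sub_nonneg.2 hcc') (by linarith : 0 ≤ l' + i)]

/- A draw has positive drift only if the proportion of `true`s exceeds `19 / 20`, which requires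
that fewer than `(j - 9 * n) / 20` of the first `j` draws are `false`. -/
lemma posDrift_plateau_le {n : ℕ} (hn : 0 < n) {c j : ℕ} (hc : c ≤ j) :
    posDrift (urnProb plateau (1 / 2, n)) c j ≤
      ENNReal.ofReal ((19 / 20) ^ (9 * n) / (19 / 20) ^ j) *
        ENNReal.ofReal (((19 / 20) ^ 20) ^ (j - c)) := by
  have : (0 : ℝ) < n := Nat.cast_pos.2 hn
  rw [posDrift, ← ENNReal.ofReal_mul (by positivity)]
  refine ENNReal.ofReal_le_ofReal ?_
  by_cases hx : (1 / 2 * (n : ℝ) + c) / (n + j) ≤ 19 / 20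
  · rw [urnProb, plateau_of_le hx]
    norm_num
    positivity
  · rw [not_le, lt_div_iff₀ (by positivity)] at hx
    have hfew : 20 * (j - c) + 9 * n ≤ j := by
      have : (19 * j + 9 * n : ℝ) < 20 * c := by linarith
      have : 19 * j + 9 * n < 20 * c := by exact_mod_cast this
      omega
    refine le_trans (b := 1) ?_ ?_
    · rw [urnProb]
      linarith [plateau_le ((1 / 2 * (n : ℝ) + c) / (n + j))]
    · rw [div_mul_eq_mul_div, le_div_iff₀ (by positivity), one_mul, ← pow_mul, ← pow_add]
      exact pow_le_pow_of_le_one (by norm_num) (by norm_num) (by omega)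

lemma exists_plateauDrift_natCast_le : ∃ K : ℝ, ∀ n : ℕ, 0 < n →
    plateauDrift n ≤ ENNReal.ofReal ((19 / 20) ^ (9 * n) * K) := by
  obtain ⟨ρ, hρ⟩ : ∃ ρ : ℝ, ρ = (9 / 10 + (1 - 9 / 10) * (19 / 20) ^ 20) / (19 / 20) := ⟨_, rfl⟩
  have hρ0 : 0 ≤ ρ := by rw [hρ]; norm_num
  have hρ1 : ρ < 1 := by rw [hρ]; norm_num
  refine ⟨(1 - ρ)⁻¹, fun n hn => ?_⟩
  have hlaw := isUrnLaw_urnLaw (urnProb_plateau_mem_Icc n)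
  have hterm : ∀ j, ∫⁻ a, posDrift (urnProb plateau (1 / 2, n)) (heads a j) j
      ∂urnLaw (urnProb plateau (1 / 2, n)) ≤ ENNReal.ofReal ((19 / 20) ^ (9 * n) * ρ ^ j) :=
    fun j => by
      refine (lintegral_mono fun a => posDrift_plateau_le hn (heads_le a j)).trans ?_
      rw [lintegral_const_mul' _ _ ENNReal.ofReal_ne_top]
      refine (mul_le_mul_right (hlaw.lintegral_pow_tails_le
        (fun c i => ⟨(urnProb_plateau_mem_Icc n c i).1, plateau_le _⟩) (by norm_num)
        (by constructor <;> norm_num) j) _).trans_eq ?_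
      rw [← ENNReal.ofReal_mul (by positivity), hρ, div_pow _ (19 / 20 : ℝ) j, div_mul_eq_mul_div,
        mul_div_assoc]
  refine (ENNReal.tsum_le_tsum hterm).trans_eq ?_
  rw [← ENNReal.ofReal_tsum_of_nonneg (fun j => by positivity)
    ((summable_geometric_of_lt_one hρ0 hρ1).mul_left _), tsum_mul_left,
    tsum_geometric_of_lt_one hρ0 hρ1]

lemma exists_plateauDrift_le_one : ∃ l : ℝ, 0 < l ∧ plateauDrift l ≤ 1 := by
  obtain ⟨K, hK⟩ := exists_plateauDrift_natCast_le
  have hlim : Tendsto (fun n : ℕ => (19 / 20 : ℝ) ^ (9 * n) * K) atTop (𝓝 (0 * K)) := by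
    simp_rw [pow_mul]
    exact (tendsto_pow_atTop_nhds_zero_of_lt_one (by norm_num) (by norm_num)).mul_const K
  rw [zero_mul] at hlim
  obtain ⟨n, hle, hn⟩ := ((hlim.eventually_le_const one_pos).and (eventually_gt_atTop 0)).exists
  exact ⟨n, Nat.cast_pos.2 hn, (hK n hn).trans (ENNReal.ofReal_le_one.2 hle)⟩

/- If `l ≤ 1 / 20`, then after `j ≥ 1` draws, all `true`, the drift is `4 / 5`; this has
probability `1 / 2 * (9 / 10) ^ (j - 1)`, and `4 / 5 * 1 / 2 * (1 + 9 / 10 + 81 / 100) > 1`. -/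
lemma one_lt_plateauDrift {l : ℝ} (hl : 0 < l) (hl' : l ≤ 1 / 20) : 1 < plateauDrift l := by
  set p := urnProb plateau (1 / 2, l) with hp
  have hzero : p 0 0 = 1 / 2 := by
    simp only [hp, urnProb, Nat.cast_zero, add_zero]
    rw [mul_div_assoc, div_self hl.ne']
    exact plateau_of_le (by norm_num)
  have hsucc : ∀ i, p (i + 1) (i + 1) = 9 / 10 := fun i => by
    refine plateau_of_ge ?_
    have : (0 : ℝ) ≤ i := i.cast_nonneg
    push_cast
    rw [le_div_iff₀ (by linarith)]
    linarith
  have hterm : ∀ j, ENNReal.ofReal (2 / 5 * (9 / 10) ^ j) ≤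
      ∫⁻ a, posDrift p (heads a (j + 1)) (j + 1) ∂urnLaw p := fun j => by
    refine le_of_eq_of_le ?_ (posDrift_mul_prod_le_lintegral (urnProb_plateau_mem_Icc l) (j + 1))
    rw [← hp, Finset.prod_range_succ', hzero, posDrift]
    simp_rw [hsucc]
    rw [Finset.prod_const, Finset.card_range, ← ENNReal.ofReal_pow (by norm_num),
      ← ENNReal.ofReal_mul (by positivity), ← ENNReal.ofReal_mul (by norm_num)]
    ring_nf
  calc (1 : ENNReal) < ENNReal.ofReal (∑ j ∈ Finset.range 3, 2 / 5 * (9 / 10) ^ j) := by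
        rw [ENNReal.one_lt_ofReal]
        norm_num [Finset.sum_range_succ]
    _ = ∑ j ∈ Finset.range 3, ENNReal.ofReal (2 / 5 * (9 / 10) ^ j) :=
        ENNReal.ofReal_sum_of_nonneg fun j _ => by positivity
    _ ≤ ∑ j ∈ Finset.range 3, ∫⁻ a, posDrift p (heads a (j + 1)) (j + 1) ∂urnLaw p :=
        Finset.sum_le_sum fun j _ => hterm j
    _ ≤ ∑' j, ∫⁻ a, posDrift p (heads a (j + 1)) (j + 1) ∂urnLaw p := ENNReal.sum_le_tsum _
    _ ≤ plateauDrift l := ENNReal.tsum_comp_le_tsum_of_injective Nat.succ_injective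
        fun j => ∫⁻ a, posDrift p (heads a j) j ∂urnLaw p

lemma siteDrift_plateau_lt_one {l : ℝ} (hl : 0 < l) (hdrift : plateauDrift l ≤ 1) (v : ℕ) :
    siteDrift (urnProb plateau (1 / 2, l)) (urnLaw (urnProb plateau (1 / 2, l))) v < 1 := by
  obtain ⟨k, hk⟩ := exists_nat_gt (9 * l)
  refine (siteDrift_lt_totalDrift (j := v + 1 + k) (fun c i => ⟨?_, (plateau_mem_Icc _).2⟩)
    (ne_top_of_le_ne_top ENNReal.one_ne_top hdrift) (by omega) (half_lt_plateau ?_)).trans_le hdrift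
  · exact one_half_pos.trans_le (half_le_plateau _)
  · have : (0 : ℝ) ≤ v := v.cast_nonneg
    push_cast
    rw [lt_div_iff₀ (by linarith)]
    linarith

lemma eventually_one_lt_plateauDrift {l : ℝ} (hl : 0 < l) (hdrift : 1 < plateauDrift l) :
    ∀ᶠ l' in 𝓝 l, 1 < plateauDrift l' := by
  refine eventually_lt_totalDrift urnProb_plateau_mem_Icc (fun c i => ?_) hdrift
  have : (0 : ℝ) ≤ i := i.cast_nonneg
  exact (contDiff_plateau (n := 0)).continuous.continuousAt.comp
    (f := fun l : ℝ => (1 / 2 * l + c) / (l + i))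
    (ContinuousAt.div (by fun_prop) (by fun_prop) (by linarith))

lemma exists_plateauDrift_le_one_iff :
    ∃ l₁ : ℝ, 0 < l₁ ∧ ∀ l : ℝ, 0 < l → (plateauDrift l ≤ 1 ↔ l₁ ≤ l) := by
  set S : Set ℝ := {l | 0 < l ∧ plateauDrift l ≤ 1}
  have hne : S.Nonempty := exists_plateauDrift_le_one
  have hlow : 1 / 20 ∈ lowerBounds S := fun l hl => by
    by_contra! hlt
    exact (one_lt_plateauDrift hl.1 hlt.le).not_ge hl.2
  have hpos : 0 < sInf S := lt_of_lt_of_le (by norm_num) (le_csInf hne hlow)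
  have hmem : plateauDrift (sInf S) ≤ 1 := by
    by_contra! hlt
    obtain ⟨l, hl, hlS⟩ := ((eventually_one_lt_plateauDrift hpos hlt).and_frequently
      ((isGLB_csInf hne ⟨_, hlow⟩).frequently_nhds_mem hne)).exists
    exact hl.not_ge hlS.2
  exact ⟨sInf S, hpos, fun l hl => ⟨fun hle => csInf_le ⟨_, hlow⟩ ⟨hl, hle⟩,
    fun hle => (plateauDrift_antitoneOn hpos hl hle).trans hmem⟩⟩

/-! ### Recurrence and transience -/

lemma measurableSet_isRecurrentPath : MeasurableSet {X : ℕ → ℤ | IsRecurrentPath X} := by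
  have hlimsup : {X : ℕ → ℤ | IsRecurrentPath X} =
      ⋂ x : ℤ, limsup (fun n : ℕ => {X : ℕ → ℤ | X n = x}) atTop := by
    ext X
    simp only [mem_iInter, mem_limsup_iff_frequently_mem]
    rfl
  rw [hlimsup]
  exact .iInter fun x => .measurableSet_limsup fun n =>
    measurableSet_eq_fun (measurable_pi_apply n) measurable_const

lemma measurableSet_isTransientPath : MeasurableSet {X : ℕ → ℤ | IsTransientPath X} :=
  (measurableSet_tendsto atTop fun n => measurable_pi_apply n).union
    (measurableSet_tendsto atBot fun n => measurable_pi_apply n)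

lemma measurePreserving_infinitePi_map_comp {ι κ α β : Type*} [MeasurableSpace α]
    [MeasurableSpace β] (ν : Measure α) [IsProbabilityMeasure ν] {e : κ → ι}
    (he : Function.Injective e) {g : α → β} (hg : Measurable g) :
    MeasurePreserving (fun (ω : ι → α) (x : κ) => g (ω (e x)))
      (Measure.infinitePi fun _ : ι => ν) (Measure.infinitePi fun _ : κ => ν.map g) := by
  have hmap : Measurable fun (ω : κ → α) (x : κ) => g (ω x) := by fun_prop
  have hcomp : Measurable fun (ω : ι → α) (x : κ) => ω (e x) := by fun_prop
  refine ⟨hmap.comp hcomp, ?_⟩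
  rw [← Measure.infinitePi_map_pi (μ := fun _ : κ => ν) fun _ => hg,
    ← Measure.map_infinitePi_infinitePi_of_inj (P := fun _ : ι => ν) he, Measure.map_map hmap hcomp]
  rfl

lemma siteDrift_eq_zero {p : ℕ → ℕ → ℝ} (hp : ∀ c i, p c i ≤ 1 / 2) (ν : Measure (ℕ → Bool))
    (v : ℕ) : siteDrift p ν v = 0 := by
  have hzero : ∀ c i, posDrift p c i = 0 := fun c i =>
    ENNReal.ofReal_of_nonpos (by linarith [hp c i])
  simp only [siteDrift, hzero, ite_self, lintegral_zero, tsum_zero]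

section Stacks

variable {ν : Measure (ℕ → Bool)} [IsProbabilityMeasure ν]

lemma ae_infinitePi_of_ae_natCast {P : (ℕ → ℕ → Bool) → Prop}
    (hP : ∀ᵐ ω ∂(Measure.infinitePi fun _ : ℕ => ν), P ω) :
    ∀ᵐ ω ∂(Measure.infinitePi fun _ : ℤ => ν), P fun x => ω x := by
  have hpres := measurePreserving_infinitePi_map_comp ν (Nat.cast_injective (R := ℤ)) measurable_id
  rw [Measure.map_id] at hpres
  exact hpres.quasiMeasurePreserving.ae hP

variable {p : ℕ → ℕ → ℝ}

/- On the left of the origin the arrows are reversed: the positive drift vanishes there. -/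
lemma ae_not_bddAbove_backwardChain_reflectStacks (hν : IsUrnLaw p ν)
    (hmix : ∀ᵐ a ∂ν, IsMixed a) (hp : ∀ c i, p c i ∈ Icc (1 / 2 : ℝ) 1) :
    ∀ᵐ ω ∂(Measure.infinitePi fun _ : ℤ => ν),
      ¬BddAbove (range (backwardChain fun x => reflectStacks ω x)) := by
  have hnot : Measurable fun (a : ℕ → Bool) (i : ℕ) => !a i :=
    measurable_pi_lambda _ fun i => (measurable_of_finite not).comp (measurable_pi_apply i)
  have := Measure.isProbabilityMeasure_map (μ := ν) hnot.aemeasurable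
  have hmix' : ∀ᵐ a ∂(ν.map fun a i => !a i), IsMixed a := by
    rw [ae_map_iff hnot.aemeasurable measurableSet_isMixed]
    exact hmix.mono fun a => IsMixed.not
  have hp' : ∀ c i, 1 - p (i - c) i ∈ Icc (0 : ℝ) (1 / 2) := fun c i =>
    ⟨by linarith [(hp (i - c) i).2], by linarith [(hp (i - c) i).1]⟩
  refine (measurePreserving_infinitePi_map_comp ν (e := fun x : ℕ => -(x : ℤ))
    (neg_injective.comp Nat.cast_injective) hnot).quasiMeasurePreserving.ae
    (ae_not_bddAbove_backwardChain hν.map_not hmix'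
      (fun c i => ⟨(hp' c i).1, by linarith [(hp' c i).2]⟩) fun v => ?_)
  rw [siteDrift_eq_zero fun c i => (hp' c i).2]
  exact one_pos

lemma ae_isRecurrentPath_walk (hν : IsUrnLaw p ν) (hmix : ∀ᵐ a ∂ν, IsMixed a)
    (hp : ∀ c i, p c i ∈ Icc (1 / 2 : ℝ) 1) (hdrift : ∀ v, siteDrift p ν v < 1) :
    ∀ᵐ ω ∂(Measure.infinitePi fun _ : ℤ => ν), IsRecurrentPath (walk ω) := by
  filter_upwards [ae_infinitePi_of_ae_natCast (ae_not_bddAbove_backwardChain hν hmix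
      (fun c i => Icc_subset_Icc_left (by norm_num) (hp c i)) hdrift),
    ae_not_bddAbove_backwardChain_reflectStacks hν hmix hp, ae_forall_infinitePi fun _ => hmix]
    with ω hr hl hω
  exact (follows_walk ω).isRecurrentPath_of_not_bddAbove hω hr hl

lemma ae_isTransientPath_walk (hν : IsUrnLaw p ν) (hmix : ∀ᵐ a ∂ν, IsMixed a)
    (hp : ∀ c i, p c i ∈ Icc (1 / 2 : ℝ) 1) (hdrift : 1 < totalDrift p ν) :
    ∀ᵐ ω ∂(Measure.infinitePi fun _ : ℤ => ν), IsTransientPath (walk ω) := by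
  filter_upwards [ae_infinitePi_of_ae_natCast (ae_bddAbove_backwardChain hν hmix hp hdrift),
    ae_forall_infinitePi fun _ => hmix] with ω hbdd hω
  exact (follows_walk ω).isTransientPath_of_bddAbove hω hbdd

end Stacks

lemma ae_isRecurrentPath_plateau {l : ℝ} (hl : 0 < l) (hdrift : plateauDrift l ≤ 1) :
    ∀ᵐ X ∂(reinforcedWalkLaw plateau 0 fun _ => (1 / 2, l)), IsRecurrentPath X := by
  rw [← map_walk_infinitePi_urnLaw plateau_mem_Icc,
    ae_map_iff measurable_walk.aemeasurable measurableSet_isRecurrentPath]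
  exact ae_isRecurrentPath_walk (isUrnLaw_urnLaw (urnProb_plateau_mem_Icc l))
    (ae_isMixed_urnLaw_plateau l)
    (fun _ _ => ⟨half_le_plateau _, (plateau_mem_Icc _).2⟩) (siteDrift_plateau_lt_one hl hdrift)

lemma ae_isTransientPath_plateau {l : ℝ} (hdrift : 1 < plateauDrift l) :
    ∀ᵐ X ∂(reinforcedWalkLaw plateau 0 fun _ => (1 / 2, l)), IsTransientPath X := by
  rw [← map_walk_infinitePi_urnLaw plateau_mem_Icc,
    ae_map_iff measurable_walk.aemeasurable measurableSet_isTransientPath]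
  exact ae_isTransientPath_walk (isUrnLaw_urnLaw (urnProb_plateau_mem_Icc l))
    (ae_isMixed_urnLaw_plateau l)
    (fun _ _ => ⟨half_le_plateau _, (plateau_mem_Icc _).2⟩) hdrift

theorem theorem3 :
    ∃ f : ℝ → ℝ, IsUrnFunction f ∧ (∀ a ∈ Icc (0 : ℝ) 1, 1 / 2 ≤ f a) ∧
      (∀ p : ℝ, IsStableFixedPoint f p ↔ p = 1 / 2) ∧
      ∃ l₁ : ℝ, 0 < l₁ ∧ ∀ l : ℝ, 0 < l →
        (l₁ ≤ l → ∀ᵐ X ∂(reinforcedWalkLaw f 0 fun _ => (1 / 2, l)), IsRecurrentPath X) ∧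
        (l < l₁ → ∀ᵐ X ∂(reinforcedWalkLaw f 0 fun _ => (1 / 2, l)), IsTransientPath X) := by
  obtain ⟨l₁, hl₁, hthreshold⟩ := exists_plateauDrift_le_one_iff
  refine ⟨plateau, isUrnFunction_plateau, fun a _ => half_le_plateau a,
    isStableFixedPoint_plateau_iff, l₁, hl₁, fun l hl => ⟨fun hle => ?_, fun hlt => ?_⟩⟩
  · exact ae_isRecurrentPath_plateau hl ((hthreshold l hl).2 hle)
  · exact ae_isTransientPath_plateau (not_le.1 (mt (hthreshold l hl).1 hlt.not_ge))
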